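/- Let $\mathbb{K}$ be a field of prime characteristic $p$ that is $F$-finite (i.e. $\mathbb{K}$ is a finite extension of its subfield $\mathbb{K}^p$). Let $m,t,n$ be positive integers, let $Y$ and $Z$ be matrices of indeterminates of sizes $m\times t$ and $t\times n$ respectively, and set $S:=\mathbb{K}[Y,Z]$. Let $(YZ)$ be the ideal of $S$ generated by the entries of the product matrix $YZ$, and for a matrix $A$ let $I_k(A)$ be the ideal generated by its size $k$ minors. For non-negative integers $r,s$ with $r+s\le t$, let $$\mathfrak{p}_{r,s}:=I_{r+1}(Y)+I_{s+1}(Z)+(YZ)\subseteq S$$ be the ideal defining the corresponding variety of complexes. (1) If $t\le\min(m,n)$, there is a single splitting $\theta$ of the Frobenius map on $S$ (i.e. an additive map $\theta:S\to S$ with $\theta(a^pb)=a\,\theta(b)$ and $\theta(a^p)=a$ for all $a,b\in S$) that compatibly splits all the varieties of complexes: $\theta(\mathfrak{p}_{r,s})\subseteq\mathfrak{p}_{r,s}$ for all non-negative integers $r,s$ with $r+s\le t$. (2) For any triple $(m,n,t)$, the generic nullcone $R:=S/(YZ)$ is $F$-pure: its Frobenius endomorphism is pure, i.e. for every $R$-module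 $M$ the map $R\otimes_R M\to F_*R\otimes_R M$ induced by Frobenius is injective, where $F_*R$ denotes $R$ regarded as an $R$-module via Frobenius. -/

import Mathlib

universe u v w

/-- A ring homomorphism `f : A → B` is pure if, for every `A`-module `M`, the map
`A ⊗ M → B ⊗ M` induced by `f` is injective; here `B` is an `A`-module through `f`. -/
def RingHomIsPure {A : Type u} {B : Type v} [CommRing A] [CommRing B] (f : A →+* B) : Prop :=
  letI : Algebra A B := f.toAlgebra
  ∀ (M : Type w) [AddCommGroup M] [Module A M],
    Function.Injective ((Algebra.linearMap A B).rTensor M)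

/-- A ring of characteristic `p` is `F`-pure if its Frobenius endomorphism is pure. -/
def IsFPure (p : ℕ) (R : Type u) [CommRing R] [ExpChar R p] : Prop :=
  RingHomIsPure.{u, u, w} (frobenius R p)

/-- A ring of characteristic `p` is `F`-finite if it is a finitely generated module over itself
through its Frobenius endomorphism. -/
def IsFFinite (p : ℕ) (R : Type u) [CommRing R] [ExpChar R p] : Prop :=
  (frobenius R p).Finite

/-- `θ` is a splitting of the Frobenius map `F` of `S`: it is `S`-linear from `S`, viewed as an
`S`-module through `F`, to `S`, and `θ ∘ F = id`. -/
structure IsFrobeniusSplitting (p : ℕ) {S : Type u} [CommRing S] [ExpChar S p]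
    (θ : S →+ S) : Prop where
  map_frobenius_mul : ∀ a b : S, θ (frobenius S p a * b) = a * θ b
  map_frobenius : ∀ a : S, θ (frobenius S p a) = a

/-- The ideal `I` is compatibly split with respect to `θ`: `θ(I) ⊆ I`. -/
def IsCompatiblySplit {S : Type u} [CommRing S] (θ : S →+ S) (I : Ideal S) : Prop :=
  ∀ f ∈ I, θ f ∈ I

/-- The ideal `I_k(A)` generated by the size `k` minors of the matrix `A`. -/
def minorsIdeal {S : Type u} [CommRing S] {a b : ℕ} (k : ℕ) (A : Matrix (Fin a) (Fin b) S) :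
    Ideal S :=
  Ideal.span {d | ∃ (f : Fin k ↪o Fin a) (g : Fin k ↪o Fin b), d = (A.submatrix f g).det}

/-- The ideal generated by the entries of the matrix `A`. -/
def entriesIdeal {S : Type u} [CommRing S] {a b : ℕ} (A : Matrix (Fin a) (Fin b) S) : Ideal S :=
  Ideal.span {c | ∃ i j, c = A i j}

/-- The polynomial ring `K[Y, Z]` in the entries of an `m × t` matrix `Y` and a `t × n`
matrix `Z` of indeterminates. -/
abbrev PolyYZ (K : Type u) [Field K] (m t n : ℕ) : Type u :=
  MvPolynomial ((Fin m × Fin t) ⊕ (Fin t × Fin n)) K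

/-- The generic `m × t` matrix `Y`. -/
noncomputable def matY (K : Type u) [Field K] (m t n : ℕ) :
    Matrix (Fin m) (Fin t) (PolyYZ K m t n) :=
  Matrix.of fun i j => MvPolynomial.X (Sum.inl (i, j))

/-- The generic `t × n` matrix `Z`. -/
noncomputable def matZ (K : Type u) [Field K] (m t n : ℕ) :
    Matrix (Fin t) (Fin n) (PolyYZ K m t n) :=
  Matrix.of fun i j => MvPolynomial.X (Sum.inr (i, j))

/-- The ideal `(YZ)` generated by the entries of the product matrix. -/
noncomputable def nullconeIdeal (K : Type u) [Field K] (m t n : ℕ) : Ideal (PolyYZ K m t n) :=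
  entriesIdeal (matY K m t n * matZ K m t n)

/-- The ideal `𝔭_{r,s} = I_{r+1}(Y) + I_{s+1}(Z) + (YZ)` of a variety of complexes. -/
noncomputable def complexIdeal (K : Type u) [Field K] (m t n r s : ℕ) :
    Ideal (PolyYZ K m t n) :=
  minorsIdeal (r + 1) (matY K m t n) + minorsIdeal (s + 1) (matZ K m t n) + nullconeIdeal K m t n

/-- The generic nullcone `K[Y, Z] / (YZ)`. -/
abbrev GenericNullcone (K : Type u) [Field K] (m t n : ℕ) : Type u :=
  PolyYZ K m t n ⧸ nullconeIdeal K m t n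

theorem nullconeIdeal_ne_top (K : Type u) [Field K] (m t n : ℕ) : nullconeIdeal K m t n ≠ ⊤ := by
  intro h
  have hle : nullconeIdeal K m t n ≤
      RingHom.ker (MvPolynomial.constantCoeff : PolyYZ K m t n →+* K) := by
    rw [nullconeIdeal, entriesIdeal, Ideal.span_le]
    rintro _ ⟨i, j, rfl⟩
    simp [Matrix.mul_apply, matY, matZ, RingHom.mem_ker]
  have h1 : (1 : PolyYZ K m t n) ∈ nullconeIdeal K m t n := by rw [h]; trivial
  simpa [RingHom.mem_ker] using hle h1

instance genericNullcone_nontrivial (K : Type u) [Field K] (m t n : ℕ) :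
    Nontrivial (GenericNullcone K m t n) :=
  Ideal.Quotient.nontrivial_iff.2 (nullconeIdeal_ne_top K m t n)

instance genericNullcone_expChar (K : Type u) [Field K] (p : ℕ) [ExpChar K p] (m t n : ℕ) :
    ExpChar (GenericNullcone K m t n) p :=
  expChar_of_injective_algebraMap (algebraMap K (GenericNullcone K m t n)).injective p

/-!
Take `t ≤ min m n`, and let `f` be the product of the diagonal minors of `Y` and of `Z` and of the
leading principal minors of `YZ`. For a suitable weight its leading monomial is the product of all
the variables, so that `θ g = Tr (f ^ (p - 1) * g)`, with `Tr` the Frobenius trace, splits Frobenius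
up to the choice of a `p`-inverse linear map of the field `K`, which always exists.

Where an `r`-minor `δ` of `Y` is invertible, the equations "rank `Y ≤ r` and `YZ = 0`" are generated
by `(m - r)(t - r) + rn` elements, and `f` vanishes on them to at least that order; hence
`f ^ (p - 1)` multiplies their ideal into its Frobenius power and `θ` preserves the contraction of
that ideal from the localization at `δ`. The same holds for "rank `Y ≤ r`" alone.

The ideals `(YZ)` and `I_{s+1}(Y)` are intersections of such contractions. Indeed, the monomials
that are not leading terms of the obvious elements of these ideals satisfy a bound on chains of
cells, and a colouring of the cells along chains produces, for every such monomial, a point with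
coordinates in a field of Hahn series that lies on the variety and whose valuations are minimal
exactly at the cells of the monomial; a reduced polynomial vanishing at all these points is zero.
The ideal `I_{s+1}(Z)` is reached by transposition, and `𝔭_{r,s}` is the sum of the three.

For arbitrary `(m, n, t)` the nullcone is a retract of one with `t ≤ min m n`, through the inclusion
of the variables and the truncation of the matrices.
-/

section FrobeniusTrace

open MvPolynomial

theorem exists_frobenius_inverse_linear (K : Type u) [Field K] (p : ℕ) [Fact p.Prime] [CharP K p] :
    ∃ φ : K →+ K, φ 1 = 1 ∧ ∀ a b, φ (a ^ p * b) = a * φ b := by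
  let F := (frobenius K p).fieldRange
  obtain ⟨ψ, hψ⟩ := LinearMap.exists_leftInverse_of_injective (Algebra.linearMap F K)
    (LinearMap.ker_eq_bot.2 (algebraMap F K).injective)
  let e : K ≃+* F := RingEquiv.ofBijective (frobenius K p).rangeRestrictField
    ⟨(frobenius K p).rangeRestrictField.injective,
      (frobenius K p).rangeRestrictField_bijective.2⟩
  have he : ∀ a, (e a : K) = a ^ p := fun a => rfl
  refine ⟨e.symm.toAddMonoidHom.comp ψ.toAddMonoidHom, ?_, fun a b => ?_⟩
  · have hψ_one : ψ 1 = 1 := by simpa using LinearMap.congr_fun hψ 1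
    simp [hψ_one]
  · have hψ_smul : ψ (a ^ p * b) = e a * ψ b := by
      rw [← he, ← smul_eq_mul (e a) (ψ b), ← map_smul]; rfl
    simp [hψ_smul]

variable {K : Type u} [Field K] {σ : Type v} [Fintype σ] (p : ℕ)

/-- The exponent `(p - 1, …, p - 1) + p • e`. The exponents of this form are those of the products
of a `p`-th power and the socle monomial modulo `p`-th powers of the variables. -/
noncomputable def frobShift (e : σ →₀ ℕ) : σ →₀ ℕ :=
  Finsupp.equivFunOnFinite.symm (fun _ => p - 1) + p • e

@[simp]
theorem frobShift_apply (e : σ →₀ ℕ) (v : σ) : frobShift p e v = p - 1 + p * e v := rfl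

theorem frobShift_mapDomain {τ : Type*} [Fintype τ] (ε : σ ≃ τ) (e : σ →₀ ℕ) :
    frobShift p (e.mapDomain ε) = (frobShift p e).mapDomain ε := by
  ext v
  obtain ⟨v, rfl⟩ := ε.surjective v
  simp only [frobShift_apply, Finsupp.mapDomain_apply ε.injective]

theorem frobShift_sub_smul {u e : σ →₀ ℕ} (h : u ≤ e) :
    frobShift p e - p • u = frobShift p (e - u) := by
  ext v
  have hv : p * u v ≤ p * e v := Nat.mul_le_mul_left _ (h v)
  simp only [Finsupp.coe_tsub, Pi.sub_apply, Finsupp.coe_smul, Pi.smul_apply, smul_eq_mul,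
    frobShift_apply, Nat.mul_sub]
  omega

variable [hp : Fact p.Prime]

theorem frobShift_injective : Function.Injective (frobShift (σ := σ) p) := by
  intro e e' h
  ext v
  simpa [hp.out.ne_zero] using DFunLike.congr_fun h v

theorem smul_le_frobShift_iff {u e : σ →₀ ℕ} : p • u ≤ frobShift p e ↔ u ≤ e := by
  refine forall_congr' fun v => ?_
  have hlt : p - 1 < p := Nat.sub_one_lt hp.out.ne_zero
  simp only [Finsupp.coe_smul, Pi.smul_apply, smul_eq_mul, frobShift_apply]
  refine ⟨fun h => Nat.lt_succ_iff.1 (Nat.lt_of_mul_lt_mul_left (a := p) ?_), fun h => ?_⟩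
  · rw [Nat.mul_succ]; omega
  · exact (Nat.mul_le_mul_left p h).trans (Nat.le_add_left _ _)

variable (φ : K →+ K)

/-- The trace of Frobenius on a polynomial ring: the generator of the maps that are linear over
Frobenius, twisted by the map `φ` of the coefficient field. -/
noncomputable def frobTrace : MvPolynomial σ K →+ MvPolynomial σ K :=
  (AddMonoidAlgebra.coeffAddEquiv.symm.toAddMonoidHom.comp
    ((Finsupp.mapRange.addMonoidHom φ).comp
      (Finsupp.comapDomain.addMonoidHom (frobShift_injective p)))).comp
    AddMonoidAlgebra.coeffAddEquiv.toAddMonoidHom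

theorem coeff_frobTrace (g : MvPolynomial σ K) (e : σ →₀ ℕ) :
    coeff e (frobTrace p φ g) = φ (coeff (frobShift p e) g) := rfl

theorem frobTrace_pow_mul [CharP K p] (hφ : ∀ a b, φ (a ^ p * b) = a * φ b)
    (a b : MvPolynomial σ K) : frobTrace p φ (a ^ p * b) = a * frobTrace p φ b := by
  induction a using MvPolynomial.induction_on' with
  | monomial u c =>
    ext e
    rw [coeff_frobTrace, monomial_pow, coeff_monomial_mul', coeff_monomial_mul']
    by_cases h : u ≤ e
    · rw [if_pos ((smul_le_frobShift_iff p).2 h), if_pos h, hφ, coeff_frobTrace,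
        frobShift_sub_smul p h]
    · rw [if_neg (mt (smul_le_frobShift_iff p).1 h), if_neg h, map_zero]
  | add a a' ha ha' => rw [add_pow_char, add_mul, map_add, ha, ha', add_mul]

theorem rename_frobTrace {τ : Type*} [Fintype τ] (ε : σ ≃ τ) (g : MvPolynomial σ K) :
    rename ε (frobTrace p φ g) = frobTrace p φ (rename ε g) := by
  ext e
  obtain ⟨e, rfl⟩ : ∃ e', e'.mapDomain ε = e :=
    ⟨e.mapDomain ε.symm, by rw [← Finsupp.mapDomain_comp]; simp⟩
  rw [coeff_rename_mapDomain _ ε.injective, coeff_frobTrace, coeff_frobTrace,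
    frobShift_mapDomain, coeff_rename_mapDomain _ ε.injective]

end FrobeniusTrace

section CompatibleSplitting

variable {S : Type u} [CommRing S]

theorem isCompatiblySplit_sup {θ : S →+ S} {I J : Ideal S} (hI : IsCompatiblySplit θ I)
    (hJ : IsCompatiblySplit θ J) : IsCompatiblySplit θ (I ⊔ J) := by
  intro f hf
  obtain ⟨a, ha, b, hb, rfl⟩ := Submodule.mem_sup.1 hf
  rw [map_add]
  exact Submodule.add_mem_sup (hI a ha) (hJ b hb)

open MvPolynomial in
theorem mem_span_range_pow_of_mem_span_range_pow {ι : Type*} [Fintype ι] (x : ι → S) {p n : ℕ}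
    (hn : Fintype.card ι * (p - 1) < n) {y : S} (hy : y ∈ Ideal.span (Set.range x) ^ n) :
    y ∈ Ideal.span (Set.range fun i => x i ^ p) := by
  obtain ⟨q, hq, rfl⟩ := (Ideal.mem_span_pow_iff_exists_isHomogeneous x y).1 hy
  rw [eval_eq]
  refine Ideal.sum_mem _ fun d hd => Ideal.mul_mem_left _ _ ?_
  have hdeg : ∑ i, d i = n := by
    rw [← hq (mem_support_iff.1 hd), Finsupp.weight_apply, Finsupp.sum_fintype _ _ (by simp)]
    simp
  obtain ⟨i, hi⟩ : ∃ i, p - 1 < d i := by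
    by_contra! h
    have hle : ∑ i, d i ≤ ∑ _i : ι, (p - 1) := Finset.sum_le_sum fun i _ => h i
    rw [Finset.sum_const, Finset.card_univ, smul_eq_mul] at hle
    omega
  have hdvd : x i ^ p ∣ ∏ j ∈ d.support, x j ^ d j :=
    (pow_dvd_pow _ (by omega)).trans (Finset.dvd_prod_of_mem (fun j => x j ^ d j)
      (Finsupp.mem_support_iff.2 (by omega)))
  exact Ideal.mem_of_dvd _ hdvd (Ideal.subset_span ⟨i, rfl⟩)

theorem map_mem_span_range_of_mem_span_range_pow {ι : Type*} [Finite ι] {x : ι → S} {p : ℕ}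
    {τ : S →+ S} (hτ : ∀ a b, τ (a ^ p * b) = a * τ b) {y : S}
    (hy : y ∈ Ideal.span (Set.range fun i => x i ^ p)) : τ y ∈ Ideal.span (Set.range x) := by
  cases nonempty_fintype ι
  obtain ⟨c, rfl⟩ := Ideal.mem_span_range_iff_exists_fun.1 hy
  rw [map_sum]
  refine Ideal.sum_mem _ fun i _ => ?_
  rw [mul_comm, hτ]
  exact Ideal.mul_mem_right _ _ (Ideal.subset_span ⟨i, rfl⟩)

/-- The saturation `H : δ^∞`: the ideal of the closure of the part of the zero locus of `H` on which
`δ` does not vanish. -/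
noncomputable def awayContraction (δ : S) (H : Ideal S) : Ideal S :=
  (H.map (algebraMap S (Localization.Away δ))).comap (algebraMap S (Localization.Away δ))

theorem map_algebraMap_away_mem_iff {δ : S} {H : Ideal S} {g : S} :
    algebraMap S (Localization.Away δ) g ∈ H.map (algebraMap S (Localization.Away δ)) ↔
      ∃ N, δ ^ N * g ∈ H := by
  rw [IsLocalization.algebraMap_mem_map_algebraMap_iff (Submonoid.powers δ)]
  exact ⟨by rintro ⟨_, ⟨N, rfl⟩, h⟩; exact ⟨N, h⟩, fun ⟨N, h⟩ => ⟨_, ⟨N, rfl⟩, h⟩⟩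

theorem map_eq_zero_of_mem_awayContraction {L : Type v} [CommRing L] [NoZeroDivisors L]
    (ψ : S →+* L) {H : Ideal S} {δ g : S} (hH : H ≤ RingHom.ker ψ) (hδ : ψ δ ≠ 0)
    (hg : g ∈ awayContraction δ H) : ψ g = 0 := by
  obtain ⟨N, hN⟩ := map_algebraMap_away_mem_iff.1 hg
  have hψ : ψ δ ^ N * ψ g = 0 := by simpa using hH hN
  exact (mul_eq_zero.1 hψ).resolve_left (pow_ne_zero _ hδ)

theorem isCompatiblySplit_awayContraction {ι : Type*} [Fintype ι] (x : ι → S) {δ f : S} {p : ℕ}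
    (hp : 0 < p) {τ : S →+ S} (hτ : ∀ a b, τ (a ^ p * b) = a * τ b)
    (hf : algebraMap S (Localization.Away δ) f ∈
      (Ideal.span (Set.range x)).map (algebraMap S (Localization.Away δ)) ^ Fintype.card ι) :
    IsCompatiblySplit (τ.comp (AddMonoidHom.mulLeft (f ^ (p - 1))))
      (awayContraction δ (Ideal.span (Set.range x))) := by
  intro g hg
  rw [← Ideal.map_pow, map_algebraMap_away_mem_iff] at hf
  obtain ⟨M, hM⟩ := hf
  obtain ⟨N, hN⟩ := map_algebraMap_away_mem_iff.1 hg
  obtain ⟨q, rfl⟩ : ∃ q, p = q + 1 := ⟨p - 1, by omega⟩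
  set k := M * q + N
  have hk : δ ^ k * (f ^ q * g) ∈ Ideal.span (Set.range x) ^ (Fintype.card ι * q + 1) := by
    rw [show δ ^ k * (f ^ q * g) = (δ ^ M * f) ^ q * (δ ^ N * g) by simp only [k]; ring, pow_succ,
      pow_mul]
    exact Ideal.mul_mem_mul (Ideal.pow_mem_pow hM _) hN
  have hkp : (δ ^ k) ^ (q + 1) * (f ^ q * g) ∈ Ideal.span (Set.range fun i => x i ^ (q + 1)) := by
    rw [pow_succ, mul_assoc]
    exact Ideal.mul_mem_left _ _
      (mem_span_range_pow_of_mem_span_range_pow x (Nat.lt_succ_self _) hk)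
  refine map_algebraMap_away_mem_iff.2 ⟨k, ?_⟩
  rw [AddMonoidHom.comp_apply, AddMonoidHom.coe_mulLeft, Nat.add_sub_cancel, ← hτ]
  exact map_mem_span_range_of_mem_span_range_pow hτ hkp

end CompatibleSplitting

section DeterminantOrder

variable {S : Type u} [CommRing S] {ι μ τ ν ρ : Type*} [Fintype ρ]

/-- The matrix `A` is the product of two matrices with inner index type `ρ`. Over a field this says
that the rank of `A` is at most the cardinality of `ρ`. -/
def MatrixFactorsThrough (ρ : Type*) [Fintype ρ] (A : Matrix μ τ S) : Prop :=
  ∃ (U : Matrix μ ρ S) (V : Matrix ρ τ S), A = U * V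

theorem MatrixFactorsThrough.submatrix {A : Matrix μ τ S} (hA : MatrixFactorsThrough ρ A)
    {μ' τ' : Type*} (f : μ' → μ) (g : τ' → τ) : MatrixFactorsThrough ρ (A.submatrix f g) := by
  obtain ⟨U, V, rfl⟩ := hA
  exact ⟨U.submatrix f id, V.submatrix id g, rfl⟩

theorem MatrixFactorsThrough.transpose {A : Matrix μ τ S} (hA : MatrixFactorsThrough ρ A) :
    MatrixFactorsThrough ρ A.transpose := by
  obtain ⟨U, V, rfl⟩ := hA
  exact ⟨V.transpose, U.transpose, Matrix.transpose_mul U V⟩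

theorem MatrixFactorsThrough.mul_right [Fintype τ] {A : Matrix μ τ S}
    (hA : MatrixFactorsThrough ρ A) (B : Matrix τ ν S) : MatrixFactorsThrough ρ (A * B) := by
  obtain ⟨U, V, rfl⟩ := hA
  exact ⟨U, V * B, Matrix.mul_assoc U V B⟩

theorem matrixFactorsThrough_fromBlocks_one_of_mul_eq_zero [Fintype τ] [DecidableEq τ]
    {Y : Matrix μ τ S} {Z : Matrix τ ν S} (hYZ : Y * Z = 0) :
    MatrixFactorsThrough τ (Matrix.fromBlocks 0 Y Z 1) :=
  ⟨Matrix.fromRows Y 1, Matrix.fromCols Z 1, by simp [hYZ]⟩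

theorem card_sub_card_le_card_isRight [Fintype ι] (σ : Equiv.Perm (ρ ⊕ ι)) :
    Fintype.card ι - Fintype.card ρ ≤ Fintype.card {i : ι // (σ (Sum.inr i)).isRight} := by
  classical
  have hle : Fintype.card {i : ι // ¬ (σ (Sum.inr i)).isRight} ≤ Fintype.card ρ := by
    refine Fintype.card_le_of_injective
      (fun i => (σ (Sum.inr i.1)).getLeft (by simpa using i.2)) fun i j hij => Subtype.ext ?_
    have hσ := congrArg (Sum.inl (β := ι)) hij
    simpa only [Sum.inl_getLeft, EmbeddingLike.apply_eq_iff_eq, Sum.inr.injEq] using hσ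
  have := Fintype.card_subtype_compl fun i : ι => (σ (Sum.inr i)).isRight
  omega

theorem det_mul_add_mem_pow [Fintype ι] [DecidableEq ι] {H : Ideal S} (U : Matrix ι ρ S)
    (V : Matrix ρ ι S) {E : Matrix ι ι S} (hE : ∀ i j, E i j ∈ H) :
    (U * V + E).det ∈ H ^ (Fintype.card ι - Fintype.card ρ) := by
  classical
  -- The determinant is that of a block matrix in which only the `ι × ι` block, `E`, lies in `H`.
  have hblock : (U * V + E).det = (Matrix.fromBlocks 1 V (-U) E).det := by
    rw [Matrix.det_fromBlocks_one₁₁, Matrix.neg_mul, sub_neg_eq_add, add_comm]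
  rw [hblock, Matrix.det_apply']
  refine Ideal.sum_mem _ fun σ _ => Ideal.mul_mem_left _ _ ?_
  rw [Fintype.prod_sum_type, ← Fintype.prod_subtype_mul_prod_subtype
    fun i => (σ (Sum.inr i)).isRight]
  refine Ideal.mul_mem_left _ _ (Ideal.mul_mem_right _ _
    (Ideal.pow_le_pow_right (card_sub_card_le_card_isRight σ) ?_))
  rw [← Finset.card_univ, ← Finset.prod_const]
  refine Ideal.prod_mem_prod fun i _ => ?_
  obtain ⟨j, hj⟩ := Sum.isRight_iff.1 i.2
  rw [hj]
  exact hE j i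

theorem det_mem_pow_of_matrixFactorsThrough [Fintype ι] [DecidableEq ι] {H : Ideal S}
    {A : Matrix ι ι S} (hA : MatrixFactorsThrough ρ (A.map (Ideal.Quotient.mk H))) :
    A.det ∈ H ^ (Fintype.card ι - Fintype.card ρ) := by
  obtain ⟨U, V, hUV⟩ := hA
  choose lift hlift using Ideal.Quotient.mk_surjective (I := H)
  have hE : ∀ i j, (A - U.map lift * V.map lift) i j ∈ H := by
    intro i j
    have hij := congrFun (congrFun hUV i) j
    rw [← Ideal.Quotient.eq_zero_iff_mem, Matrix.sub_apply, map_sub, sub_eq_zero]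
    simpa [Matrix.mul_apply, hlift] using hij
  simpa using det_mul_add_mem_pow (U.map lift) (V.map lift) hE

end DeterminantOrder

section SchurDefect

variable {S : Type u} [CommRing S] {μ τ ν ρ : Type*} [Fintype ρ] [DecidableEq ρ]

/-- The matrix of the minors of `Y` that border the minor with rows `R` and columns `C`: up to the
factor `det (Y.submatrix R C)`, it is the Schur complement of that block. -/
def schurDefect (Y : Matrix μ τ S) (R : ρ → μ) (C : ρ → τ) : Matrix μ τ S :=
  (Y.submatrix R C).det • Y -
    Y.submatrix id C * ((Y.submatrix R C).adjugate * Y.submatrix R id)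

theorem schurDefect_submatrix_row (Y : Matrix μ τ S) (R : ρ → μ) (C : ρ → τ) :
    (schurDefect Y R C).submatrix R id = 0 := by
  have h : Y.submatrix R C * ((Y.submatrix R C).adjugate * Y.submatrix R id) =
      (Y.submatrix R C).det • Y.submatrix R id := by
    rw [← Matrix.mul_assoc, Matrix.mul_adjugate, Matrix.smul_mul, Matrix.one_mul]
  exact sub_eq_zero.2 h.symm

theorem schurDefect_submatrix_col (Y : Matrix μ τ S) (R : ρ → μ) (C : ρ → τ) :
    (schurDefect Y R C).submatrix id C = 0 := by
  have h : Y.submatrix id C * ((Y.submatrix R C).adjugate * Y.submatrix R C) =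
      (Y.submatrix R C).det • Y.submatrix id C := by
    rw [Matrix.adjugate_mul, Matrix.mul_smul, Matrix.mul_one]
  exact sub_eq_zero.2 h.symm

theorem schurDefect_eq_zero_of_compl (Y : Matrix μ τ S) (R : ρ → μ) (C : ρ → τ)
    (h : ∀ i ∉ Set.range R, ∀ c ∉ Set.range C, schurDefect Y R C i c = 0) :
    schurDefect Y R C = 0 := by
  ext i c
  by_cases hi : i ∈ Set.range R
  · obtain ⟨l, rfl⟩ := hi
    exact congrFun (congrFun (schurDefect_submatrix_row Y R C) l) c
  by_cases hc : c ∈ Set.range C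
  · obtain ⟨l, rfl⟩ := hc
    exact congrFun (congrFun (schurDefect_submatrix_col Y R C) i) l
  exact h i hi c hc

theorem map_schurDefect {S' : Type v} [CommRing S'] (ψ : S →+* S') (Y : Matrix μ τ S)
    (R : ρ → μ) (C : ρ → τ) : (schurDefect Y R C).map ψ = schurDefect (Y.map ψ) R C := by
  have hadj := RingHom.map_adjugate ψ (Y.submatrix R C)
  have hdet := RingHom.map_det ψ (Y.submatrix R C)
  simp only [RingHom.mapMatrix_apply, ← Matrix.submatrix_map] at hadj hdet
  rw [schurDefect, schurDefect, ← hadj, ← hdet, Matrix.map_sub ψ (map_sub ψ), Matrix.map_mul,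
    Matrix.map_mul]
  congr 1
  ext i c
  exact map_mul ψ _ _

theorem eq_mul_inv_mul_of_schurDefect_eq_zero {Y : Matrix μ τ S} {R : ρ → μ} {C : ρ → τ}
    (hδ : IsUnit (Y.submatrix R C).det) (h : schurDefect Y R C = 0) :
    Y = Y.submatrix id C * ((Y.submatrix R C)⁻¹ * Y.submatrix R id) := by
  rw [Matrix.inv_def, Matrix.smul_mul, Matrix.mul_smul, ← sub_eq_zero.1 h, smul_smul,
    Ring.inverse_mul_cancel _ hδ, one_smul]

theorem schurDefect_eq_zero_of_det_eq_zero {Y : Matrix μ τ S} {R : ρ → μ} {C : ρ → τ}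
    (hδ : IsUnit (Y.submatrix R C).det)
    (hdet : ∀ i c, (Y.submatrix (Sum.elim R fun _ : Unit => i)
      (Sum.elim C fun _ : Unit => c)).det = 0) :
    schurDefect Y R C = 0 := by
  have := Matrix.invertibleOfIsUnitDet _ hδ
  ext i c
  have hblock : Y.submatrix (Sum.elim R fun _ : Unit => i) (Sum.elim C fun _ : Unit => c) =
      Matrix.fromBlocks (Y.submatrix R C) (Y.submatrix R fun _ => c) (Y.submatrix (fun _ => i) C)
        (Y.submatrix (fun _ => i) fun _ => c) := by
    ext (x | x) (y | y) <;> rfl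
  have hschur := hdet i c
  rw [hblock, Matrix.det_fromBlocks₁₁, hδ.mul_right_eq_zero, Matrix.det_unique,
    Matrix.sub_apply, sub_eq_zero, Matrix.mul_assoc] at hschur
  have hadj : (Y.submatrix R C).adjugate = (Y.submatrix R C).det • ⅟(Y.submatrix R C) := by
    rw [Matrix.invOf_eq_nonsing_inv, Matrix.inv_def, smul_smul, Ring.mul_inverse_cancel _ hδ,
      one_smul]
  rw [schurDefect, hadj, Matrix.smul_mul, Matrix.mul_smul, ← smul_sub, Matrix.smul_apply,
    Matrix.sub_apply, Matrix.zero_apply, smul_eq_mul, hδ.mul_right_eq_zero, sub_eq_zero]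
  exact hschur

variable [Fintype τ] [DecidableEq τ]

/-- `1 - ι A⁻¹ Y_R`, where `ι` includes the coordinates in `C`, is a projection to the kernel of `Y`
along these coordinates, so that it only involves the columns outside `C`. -/
theorem matrixFactorsThrough_compl_range {Y : Matrix μ τ S} {R : ρ → μ} {C : ρ → τ}
    (hδ : IsUnit (Y.submatrix R C).det) {Z : Matrix τ ν S} (hZ : Y.submatrix R id * Z = 0) :
    MatrixFactorsThrough ((Set.range C)ᶜ : Set τ) Z := by
  classical
  set B : Matrix ρ τ S := (Y.submatrix R C)⁻¹ * Y.submatrix R id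
  set P : Matrix τ τ S := 1 - (1 : Matrix τ τ S).submatrix id C * B with hP
  have hPZ : P * Z = Z := by
    rw [hP, Matrix.sub_mul, Matrix.mul_assoc, Matrix.mul_assoc, hZ]
    simp
  have hBC : B.submatrix id C = 1 := Matrix.nonsing_inv_mul _ hδ
  have hPC : ∀ c l, P c (C l) = 0 := by
    intro c l
    have h : (1 : Matrix τ τ S).submatrix id C * B.submatrix id C =
      (1 : Matrix τ τ S).submatrix id C := by rw [hBC, Matrix.mul_one]
    exact sub_eq_zero.2 (congrFun (congrFun h c) l).symm
  refine ⟨P.submatrix id Subtype.val, Z.submatrix Subtype.val id, ?_⟩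
  ext c j
  rw [← congrFun (congrFun hPZ c) j, Matrix.mul_apply, Matrix.mul_apply,
    ← Fintype.sum_subtype_add_sum_subtype (· ∈ (Set.range C)ᶜ)]
  refine (add_eq_left.2 (Finset.sum_eq_zero fun x _ => ?_))
  obtain ⟨l, hl⟩ := not_not.1 x.2
  rw [← hl, hPC, zero_mul]

end SchurDefect

section OrderArithmetic

theorem sum_min_sub (t q r : ℕ) :
    ∑ d : Fin (t + q), (min t (t + q - d) - r) =
      ∑ d ∈ Finset.range t, (d + 1 - r) + q * (t - r) := by
  rw [Fin.sum_univ_eq_sum_range (fun d => min t (t + q - d) - r) (t + q),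
    ← Finset.sum_range_reflect, Finset.sum_range_add]
  congr 1
  · refine Finset.sum_congr rfl fun d hd => ?_
    have := Finset.mem_range.1 hd
    omega
  · rw [Finset.sum_congr rfl (g := fun _ => t - r), Finset.sum_const, Finset.card_range,
      smul_eq_mul]
    intro d hd
    have := Finset.mem_range.1 hd
    omega

theorem two_mul_sum_range_succ_sub (a r : ℕ) :
    2 * ∑ d ∈ Finset.range (a + r), (d + 1 - r) = a * (a + 1) := by
  induction a with
  | zero =>
    rw [Finset.sum_eq_zero, mul_zero, zero_mul]
    intro d hd
    have := Finset.mem_range.1 hd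
    omega
  | succ a ih =>
    rw [Nat.add_right_comm, Finset.sum_range_succ, mul_add, ih]
    have : a + r + 1 - r = a + 1 := by omega
    rw [this]; ring

theorem two_mul_sum_range_sub (a r : ℕ) :
    2 * ∑ d ∈ Finset.range (a + r), (d - r) + a = a * a := by
  induction a with
  | zero =>
    rw [Finset.sum_eq_zero, mul_zero, mul_zero, add_zero]
    intro d hd
    have := Finset.mem_range.1 hd
    omega
  | succ a ih =>
    rw [Nat.add_right_comm, Finset.sum_range_succ]
    have : a + r - r = a := by omega
    rw [this]; linarith

theorem det_order_count {m t r : ℕ} (hm : t ≤ m) (hr : r ≤ t) :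
    (m - r) * (t - r) ≤
      ∑ d : Fin m, (min t (m - d) - r) + ∑ k : Fin t, ((k : ℕ) - r) := by
  obtain ⟨q, rfl⟩ := Nat.exists_eq_add_of_le hm
  obtain ⟨a, rfl⟩ := Nat.exists_eq_add_of_le' hr
  rw [sum_min_sub, Fin.sum_univ_eq_sum_range (fun k => k - r) (a + r)]
  have htriangle := two_mul_sum_range_succ_sub a r
  have hpred := two_mul_sum_range_sub a r
  have ha : a + r - r = a := by omega
  have haq : a + r + q - r = a + q := by omega
  rw [ha, haq]
  nlinarith

theorem nullcone_order_count {m t n r : ℕ} (hm : t ≤ m) (hn : t ≤ n) (hr : r ≤ t) :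
    (m - r) * (t - r) + r * n ≤
      ∑ d : Fin m, (min t (m - d) - r) + ∑ d : Fin n, (min t (n - d) - (t - r)) +
        ∑ k : Fin t, (k : ℕ) := by
  obtain ⟨q, rfl⟩ := Nat.exists_eq_add_of_le hm
  obtain ⟨q', rfl⟩ := Nat.exists_eq_add_of_le hn
  obtain ⟨a, rfl⟩ := Nat.exists_eq_add_of_le' hr
  rw [sum_min_sub, sum_min_sub, Fin.sum_univ_eq_sum_range (fun k => k) (a + r)]
  have htriangle_a := two_mul_sum_range_succ_sub a r
  have htriangle_r := two_mul_sum_range_succ_sub r a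
  rw [add_comm r a] at htriangle_r
  have hpred := two_mul_sum_range_sub (a + r) 0
  simp only [add_zero, Nat.sub_zero] at hpred
  have ha : a + r - r = a := by omega
  have haq : a + r + q - r = a + q := by omega
  have hr_eq : a + r - a = r := by omega
  rw [ha, haq, hr_eq]
  nlinarith

end OrderArithmetic

section SplittingPolynomial

variable {S : Type u} [CommRing S] {m t n : ℕ}

/-- The minor of `A` on the diagonal through the entry `(d, 0)`. -/
def diagMinor (A : Matrix (Fin m) (Fin t) S) (d : Fin m) : S :=
  (A.submatrix (fun l : Fin (min t (m - d)) => (⟨d + l, by omega⟩ : Fin m))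
    (Fin.castLE (min_le_left _ _))).det

/-- The leading principal `k`-minor of `Y * Z`. -/
def productMinor (hm : t ≤ m) (hn : t ≤ n) (Y : Matrix (Fin m) (Fin t) S)
    (Z : Matrix (Fin t) (Fin n) S) (k : Fin t) : S :=
  ((Y * Z).submatrix (Fin.castLE (k.2.le.trans hm)) (Fin.castLE (k.2.le.trans hn))).det

/-- The polynomial whose `(p - 1)`-st power gives the splitting: with respect to a suitable weight,
its leading monomial is the product of all the variables. -/
def splittingPoly (hm : t ≤ m) (hn : t ≤ n) (Y : Matrix (Fin m) (Fin t) S)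
    (Z : Matrix (Fin t) (Fin n) S) : S :=
  (∏ d, diagMinor Y d) * (∏ d, diagMinor Z.transpose d) * ∏ k, productMinor hm hn Y Z k

theorem splittingPoly_transpose (hm : t ≤ m) (hn : t ≤ n) (Y : Matrix (Fin m) (Fin t) S)
    (Z : Matrix (Fin t) (Fin n) S) :
    splittingPoly hn hm Z.transpose Y.transpose = splittingPoly hm hn Y Z := by
  have hprod : ∀ k, productMinor hn hm Z.transpose Y.transpose k = productMinor hm hn Y Z k := by
    intro k
    rw [productMinor, productMinor, ← Matrix.transpose_mul, ← Matrix.transpose_submatrix,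
      Matrix.det_transpose]
  simp only [splittingPoly, hprod, Matrix.transpose_transpose]
  ring

theorem map_splittingPoly {S' : Type v} [CommRing S'] (ψ : S →+* S') (hm : t ≤ m) (hn : t ≤ n)
    (Y : Matrix (Fin m) (Fin t) S) (Z : Matrix (Fin t) (Fin n) S) :
    ψ (splittingPoly hm hn Y Z) = splittingPoly hm hn (Y.map ψ) (Z.map ψ) := by
  simp only [splittingPoly, map_mul, map_prod, diagMinor, productMinor, RingHom.map_det,
    RingHom.mapMatrix_apply, ← Matrix.submatrix_map, Matrix.map_mul, Matrix.transpose_map]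

section Order

variable {ρ : Type*} [Fintype ρ] {H : Ideal S}

theorem prod_mem_pow_sum {ι : Type*} [Fintype ι] {x : ι → S} {e : ι → ℕ}
    (h : ∀ i, x i ∈ H ^ e i) : ∏ i, x i ∈ H ^ ∑ i, e i := by
  rw [← Finset.prod_pow_eq_pow_sum]
  exact Ideal.prod_mem_prod fun i _ => h i

theorem det_submatrix_mem_pow {μ τ : Type*} {A : Matrix μ τ S}
    (hA : MatrixFactorsThrough ρ (A.map (Ideal.Quotient.mk H))) {k : ℕ} (f : Fin k → μ)
    (g : Fin k → τ) : (A.submatrix f g).det ∈ H ^ (k - Fintype.card ρ) := by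
  simpa using det_mem_pow_of_matrixFactorsThrough (A := A.submatrix f g) (hA.submatrix f g)

theorem prod_diagMinor_mem_pow {A : Matrix (Fin m) (Fin t) S}
    (hA : MatrixFactorsThrough ρ (A.map (Ideal.Quotient.mk H))) :
    ∏ d, diagMinor A d ∈ H ^ ∑ d : Fin m, (min t (m - d) - Fintype.card ρ) :=
  prod_mem_pow_sum fun _ => det_submatrix_mem_pow hA _ _

theorem prod_productMinor_mem_pow (hm : t ≤ m) (hn : t ≤ n) {Y : Matrix (Fin m) (Fin t) S}
    {Z : Matrix (Fin t) (Fin n) S}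
    (hYZ : MatrixFactorsThrough ρ ((Y * Z).map (Ideal.Quotient.mk H))) :
    ∏ k, productMinor hm hn Y Z k ∈ H ^ ∑ k : Fin t, ((k : ℕ) - Fintype.card ρ) :=
  prod_mem_pow_sum fun _ => det_submatrix_mem_pow hYZ _ _

theorem splittingPoly_mem_pow_of_matrixFactorsThrough (hm : t ≤ m) (hn : t ≤ n)
    {Y : Matrix (Fin m) (Fin t) S} (Z : Matrix (Fin t) (Fin n) S) (hρ : Fintype.card ρ ≤ t)
    (hY : MatrixFactorsThrough ρ (Y.map (Ideal.Quotient.mk H))) :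
    splittingPoly hm hn Y Z ∈ H ^ ((m - Fintype.card ρ) * (t - Fintype.card ρ)) := by
  have hYZ : MatrixFactorsThrough ρ ((Y * Z).map (Ideal.Quotient.mk H)) := by
    rw [Matrix.map_mul]
    exact hY.mul_right _
  refine Ideal.pow_le_pow_right (det_order_count hm hρ) ?_
  rw [splittingPoly, mul_right_comm, pow_add]
  exact Ideal.mul_mem_right _ _
    (Ideal.mul_mem_mul (prod_diagMinor_mem_pow hY) (prod_productMinor_mem_pow hm hn hYZ))

theorem splittingPoly_mem_pow_of_mul_eq_zero {r : ℕ} (hm : t ≤ m) (hn : t ≤ n) (hr : r ≤ t)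
    (hρ : Fintype.card ρ = t - r) {Y : Matrix (Fin m) (Fin t) S} {Z : Matrix (Fin t) (Fin n) S}
    (hY : MatrixFactorsThrough (Fin r) (Y.map (Ideal.Quotient.mk H)))
    (hZ : MatrixFactorsThrough ρ (Z.map (Ideal.Quotient.mk H)))
    (hYZ : Y.map (Ideal.Quotient.mk H) * Z.map (Ideal.Quotient.mk H) = 0) :
    splittingPoly hm hn Y Z ∈ H ^ ((m - r) * (t - r) + r * n) := by
  have hprod : MatrixFactorsThrough (Fin 0) ((Y * Z).map (Ideal.Quotient.mk H)) :=
    ⟨0, 0, by rw [Matrix.map_mul, hYZ, Matrix.mul_zero]⟩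
  have hdiagZ : ∏ d, diagMinor Z.transpose d ∈ H ^ ∑ d : Fin n, (min t (n - d) - (t - r)) := by
    rw [← hρ]
    exact prod_diagMinor_mem_pow hZ.transpose
  refine Ideal.pow_le_pow_right (nullcone_order_count hm hn hr) ?_
  rw [splittingPoly, pow_add, pow_add]
  simpa using Ideal.mul_mem_mul (Ideal.mul_mem_mul (prod_diagMinor_mem_pow hY) hdiagZ)
    (prod_productMinor_mem_pow hm hn hprod)

end Order

section Strata

variable {r : ℕ} (Y : Matrix (Fin m) (Fin t) S) (Z : Matrix (Fin t) (Fin n) S)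
  (R : Fin r ↪ Fin m) (C : Fin r ↪ Fin t)

/-- Equations of the locus `rank Y ≤ r` where the minor of `Y` with rows `R` and columns `C` does
not vanish. -/
def rankGens : ((Set.range R)ᶜ : Set (Fin m)) × ((Set.range C)ᶜ : Set (Fin t)) → S :=
  fun x => schurDefect Y R C x.1 x.2

/-- Equations of the locus `Y * Z = 0`, `rank Y ≤ r` where the minor of `Y` with rows `R` and
columns `C` does not vanish. -/
def nullconeGens : ((Set.range R)ᶜ : Set (Fin m)) × ((Set.range C)ᶜ : Set (Fin t)) ⊕
    Fin r × Fin n → S :=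
  Sum.elim (rankGens Y R C) fun x => (Y * Z) (R x.1) x.2

/-- The ideal of the closure of the locus `rank Y ≤ r` where the minor of `Y` with rows `R` and
columns `C` does not vanish. -/
noncomputable def rankStratum : Ideal S :=
  awayContraction (Y.submatrix R C).det (Ideal.span (Set.range (rankGens Y R C)))

/-- The ideal of the closure of the locus `Y * Z = 0`, `rank Y ≤ r` where the minor of `Y` with
rows `R` and columns `C` does not vanish. -/
noncomputable def nullconeStratum : Ideal S :=
  awayContraction (Y.submatrix R C).det (Ideal.span (Set.range (nullconeGens Y Z R C)))

variable {Y Z R C}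

theorem schurDefect_map_eq_zero {S' : Type v} [CommRing S'] {ψ : S →+* S'}
    (h : ∀ x, ψ (rankGens Y R C x) = 0) : schurDefect (Y.map ψ) R C = 0 := by
  refine schurDefect_eq_zero_of_compl _ _ _ fun i hi c hc => ?_
  rw [← map_schurDefect]
  exact h ⟨⟨i, hi⟩, ⟨c, hc⟩⟩

theorem isUnit_det_map {S' : Type v} [CommRing S'] {ψ : S →+* S'}
    (hδ : IsUnit (ψ (Y.submatrix R C).det)) : IsUnit ((Y.map ψ).submatrix R C).det := by
  rwa [RingHom.map_det, RingHom.mapMatrix_apply, ← Matrix.submatrix_map] at hδ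

theorem matrixFactorsThrough_of_rankGens {S' : Type v} [CommRing S'] {ψ : S →+* S'}
    (hδ : IsUnit (ψ (Y.submatrix R C).det)) (h : ∀ x, ψ (rankGens Y R C x) = 0) :
    MatrixFactorsThrough (Fin r) (Y.map ψ) :=
  ⟨_, _, eq_mul_inv_mul_of_schurDefect_eq_zero (isUnit_det_map hδ) (schurDefect_map_eq_zero h)⟩

theorem submatrix_mul_eq_zero_of_nullconeGens {S' : Type v} [CommRing S'] {ψ : S →+* S'}
    (h : ∀ x, ψ (nullconeGens Y Z R C x) = 0) : (Y.map ψ).submatrix R id * Z.map ψ = 0 := by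
  ext l j
  simpa [nullconeGens, Matrix.mul_apply] using h (Sum.inr (l, j))

theorem map_mul_map_eq_zero_of_nullconeGens {S' : Type v} [CommRing S'] {ψ : S →+* S'}
    (hδ : IsUnit (ψ (Y.submatrix R C).det)) (h : ∀ x, ψ (nullconeGens Y Z R C x) = 0) :
    Y.map ψ * Z.map ψ = 0 := by
  rw [eq_mul_inv_mul_of_schurDefect_eq_zero (isUnit_det_map hδ)
    (schurDefect_map_eq_zero fun x => h (Sum.inl x)), Matrix.mul_assoc, Matrix.mul_assoc,
    submatrix_mul_eq_zero_of_nullconeGens h, Matrix.mul_zero, Matrix.mul_zero]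

variable (Y Z R C)

/-- Reduction modulo `H` on the part of the spectrum where `δ` is invertible. -/
noncomputable def awayQuotient (δ : S) (H : Ideal S) :
    S →+* Localization.Away δ ⧸ H.map (algebraMap S (Localization.Away δ)) :=
  (Ideal.Quotient.mk _).comp (algebraMap S (Localization.Away δ))

theorem isUnit_awayQuotient (δ : S) (H : Ideal S) : IsUnit (awayQuotient δ H δ) :=
  (IsLocalization.Away.algebraMap_isUnit (S := Localization.Away δ) δ).map (Ideal.Quotient.mk _)

theorem mem_awayContraction_iff_awayQuotient_eq_zero {δ : S} {H : Ideal S} {g : S} :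
    g ∈ awayContraction δ H ↔ awayQuotient δ H g = 0 :=
  (Ideal.Quotient.eq_zero_iff_mem (I := H.map (algebraMap S (Localization.Away δ)))).symm

theorem awayQuotient_eq_zero_of_mem_range {ι : Type*} (δ : S) (x : ι → S) (i : ι) :
    awayQuotient δ (Ideal.span (Set.range x)) (x i) = 0 :=
  Ideal.Quotient.eq_zero_iff_mem.2 (Ideal.mem_map_of_mem _ (Ideal.subset_span ⟨i, rfl⟩))

theorem card_compl_range {α : Type*} [Fintype α] [DecidableEq α] (f : Fin r ↪ α) :
    Fintype.card ((Set.range f)ᶜ : Set α) = Fintype.card α - r := by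
  rw [Fintype.card_compl_set, Set.card_range_of_injective f.injective, Fintype.card_fin]

theorem le_of_fin_embedding (C : Fin r ↪ Fin t) : r ≤ t := by
  simpa using Fintype.card_le_of_embedding C

theorem algebraMap_splittingPoly_mem_pow_rankGens (hm : t ≤ m) (hn : t ≤ n) :
    algebraMap S (Localization.Away (Y.submatrix R C).det) (splittingPoly hm hn Y Z) ∈
      (Ideal.span (Set.range (rankGens Y R C))).map
        (algebraMap S (Localization.Away (Y.submatrix R C).det)) ^
        Fintype.card (((Set.range R)ᶜ : Set (Fin m)) × ((Set.range C)ᶜ : Set (Fin t))) := by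
  rw [map_splittingPoly, Fintype.card_prod, card_compl_range, card_compl_range]
  have hY := matrixFactorsThrough_of_rankGens (isUnit_awayQuotient _ _)
    (awayQuotient_eq_zero_of_mem_range (Y.submatrix R C).det (rankGens Y R C))
  have hmem := splittingPoly_mem_pow_of_matrixFactorsThrough hm hn (Y := Y.map (algebraMap S _))
    (Z.map (algebraMap S _)) (by simpa using le_of_fin_embedding C) hY
  simpa only [Fintype.card_fin] using hmem

theorem algebraMap_splittingPoly_mem_pow_nullconeGens (hm : t ≤ m) (hn : t ≤ n) :
    algebraMap S (Localization.Away (Y.submatrix R C).det) (splittingPoly hm hn Y Z) ∈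
      (Ideal.span (Set.range (nullconeGens Y Z R C))).map
        (algebraMap S (Localization.Away (Y.submatrix R C).det)) ^
        Fintype.card (((Set.range R)ᶜ : Set (Fin m)) × ((Set.range C)ᶜ : Set (Fin t)) ⊕
          Fin r × Fin n) := by
  rw [map_splittingPoly, Fintype.card_sum, Fintype.card_prod, card_compl_range, card_compl_range,
    Fintype.card_prod]
  simp only [Fintype.card_fin]
  set δ := (Y.submatrix R C).det
  have hδ := isUnit_awayQuotient δ (Ideal.span (Set.range (nullconeGens Y Z R C)))
  have hgens := awayQuotient_eq_zero_of_mem_range δ (nullconeGens Y Z R C)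
  have hY := matrixFactorsThrough_of_rankGens hδ fun x => hgens (Sum.inl x)
  have hZ := matrixFactorsThrough_compl_range (isUnit_det_map hδ)
    (submatrix_mul_eq_zero_of_nullconeGens hgens)
  have hYZ := map_mul_map_eq_zero_of_nullconeGens hδ hgens
  exact splittingPoly_mem_pow_of_mul_eq_zero hm hn (le_of_fin_embedding C)
    (by rw [card_compl_range, Fintype.card_fin]) hY hZ hYZ

theorem isCompatiblySplit_rankStratum {p : ℕ} (hp : 0 < p) {τ : S →+ S}
    (hτ : ∀ a b, τ (a ^ p * b) = a * τ b) (hm : t ≤ m) (hn : t ≤ n) :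
    IsCompatiblySplit (τ.comp (AddMonoidHom.mulLeft (splittingPoly hm hn Y Z ^ (p - 1))))
      (rankStratum Y R C) :=
  isCompatiblySplit_awayContraction _ hp hτ
    (algebraMap_splittingPoly_mem_pow_rankGens Y Z R C hm hn)

theorem isCompatiblySplit_nullconeStratum {p : ℕ} (hp : 0 < p) {τ : S →+ S}
    (hτ : ∀ a b, τ (a ^ p * b) = a * τ b) (hm : t ≤ m) (hn : t ≤ n) :
    IsCompatiblySplit (τ.comp (AddMonoidHom.mulLeft (splittingPoly hm hn Y Z ^ (p - 1))))
      (nullconeStratum Y Z R C) :=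
  isCompatiblySplit_awayContraction _ hp hτ
    (algebraMap_splittingPoly_mem_pow_nullconeGens Y Z R C hm hn)

theorem entriesIdeal_mul_le_nullconeStratum : entriesIdeal (Y * Z) ≤ nullconeStratum Y Z R C := by
  refine Ideal.span_le.2 ?_
  rintro _ ⟨i, j, rfl⟩
  have hYZ := map_mul_map_eq_zero_of_nullconeGens (isUnit_awayQuotient _ _)
    (awayQuotient_eq_zero_of_mem_range (Y.submatrix R C).det (nullconeGens Y Z R C))
  rw [← Matrix.map_mul] at hYZ
  exact mem_awayContraction_iff_awayQuotient_eq_zero.2 (congrFun (congrFun hYZ i) j)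

theorem minorsIdeal_succ_le_rankStratum {s : ℕ} (hs : r ≤ s) :
    minorsIdeal (s + 1) Y ≤ rankStratum Y R C := by
  refine Ideal.span_le.2 ?_
  rintro _ ⟨f, g, rfl⟩
  have hY := matrixFactorsThrough_of_rankGens (isUnit_awayQuotient _ _)
    (awayQuotient_eq_zero_of_mem_range (Y.submatrix R C).det (rankGens Y R C))
  have hmem := det_submatrix_mem_pow (A := Y.map (algebraMap S _)) hY f g
  rw [Matrix.submatrix_map, ← RingHom.mapMatrix_apply, ← RingHom.map_det] at hmem
  have hpos : s + 1 - Fintype.card (Fin r) ≠ 0 := by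
    rw [Fintype.card_fin]
    omega
  have hmem_map := Ideal.pow_le_self hpos hmem
  exact hmem_map

end Strata

end SplittingPolynomial

section MixedMatrix

variable {S : Type u} [CommRing S] {μ τ ν α β κ : Type*}

/-- The rows `i`, `d`, `e` of the block matrix with rows `(0, Y)` and `(Z, 1)`. -/
def mixedRow (i : α → μ) (d : β → τ) (e : κ → τ) : (α ⊕ β) ⊕ κ → μ ⊕ τ :=
  Sum.elim (Sum.elim (Sum.inl ∘ i) (Sum.inr ∘ d)) (Sum.inr ∘ e)

/-- The columns `c`, `j`, `e` of the block matrix with rows `(0, Y)` and `(Z, 1)`. -/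
def mixedCol (c : α → τ) (j : β → ν) (e : κ → τ) : (α ⊕ β) ⊕ κ → ν ⊕ τ :=
  Sum.elim (Sum.elim (Sum.inr ∘ c) (Sum.inl ∘ j)) (Sum.inr ∘ e)

/-- The square submatrix of the block matrix with rows `(0, Y)` and `(Z, 1)` given by the rows `i`,
`d`, `e` and the columns `c`, `j`, `e`. Where `Y * Z = 0` the block matrix has rank at most the size
of the identity block, so that all its larger minors lie in the ideal of the entries of `Y * Z`. -/
def mixedMatrix [DecidableEq τ] (Y : Matrix μ τ S) (Z : Matrix τ ν S) (i : α → μ) (c : α → τ)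
    (d : β → τ) (j : β → ν) (e : κ → τ) : Matrix ((α ⊕ β) ⊕ κ) ((α ⊕ β) ⊕ κ) S :=
  (Matrix.fromBlocks 0 Y Z 1).submatrix (mixedRow i d e) (mixedCol c j e)

theorem submatrix_mul_of_bijective [Fintype τ] [Fintype α] [Fintype κ]
    (Y : Matrix μ τ S) (Z : Matrix τ ν S) (i : α → μ) (j : β → ν) {c : α → τ} {e : κ → τ}
    (h : Function.Bijective (Sum.elim c e)) : (Y * Z).submatrix i j =
      Y.submatrix i c * Z.submatrix c j + Y.submatrix i e * Z.submatrix e j := by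
  ext x y
  simp only [Matrix.submatrix_apply, Matrix.add_apply, Matrix.mul_apply]
  rw [← h.sum_comp, Fintype.sum_sum_type]
  rfl

variable [Fintype τ] [DecidableEq τ] [Fintype α] [DecidableEq α] [Fintype κ] [DecidableEq κ]

theorem det_mixedMatrix_mem_pow [Fintype β] [DecidableEq β] {H : Ideal S} {Y : Matrix μ τ S}
    {Z : Matrix τ ν S} (hYZ : ∀ i j, (Y * Z) i j ∈ H) (i : α → μ) (c : α → τ)
    (d : β → τ) (j : β → ν) (e : κ → τ) :
    (mixedMatrix Y Z i c d j e).det ∈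
      H ^ (Fintype.card α + Fintype.card β + Fintype.card κ - Fintype.card τ) := by
  have hmul : Y.map (Ideal.Quotient.mk H) * Z.map (Ideal.Quotient.mk H) = 0 := by
    ext i j
    rw [← Matrix.map_mul]
    exact Ideal.Quotient.eq_zero_iff_mem.2 (hYZ i j)
  have hmap : (Matrix.fromBlocks 0 Y Z 1).map (Ideal.Quotient.mk H) =
      Matrix.fromBlocks 0 (Y.map (Ideal.Quotient.mk H)) (Z.map (Ideal.Quotient.mk H)) 1 := by
    rw [Matrix.fromBlocks_map, Matrix.map_zero _ (map_zero _),
      Matrix.map_one _ (map_zero _) (map_one _)]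
  have hfactor : MatrixFactorsThrough τ
      ((Matrix.fromBlocks 0 Y Z 1).map (Ideal.Quotient.mk H)) :=
    hmap ▸ matrixFactorsThrough_fromBlocks_one_of_mul_eq_zero hmul
  have h := det_mem_pow_of_matrixFactorsThrough (A := mixedMatrix Y Z i c d j e)
    (hfactor.submatrix _ _)
  rwa [Fintype.card_sum, Fintype.card_sum] at h

theorem det_fromBlocks_one₂₁ (A B D : Matrix κ κ S) :
    (Matrix.fromBlocks A B 1 D).det = (A * D - B).det := by
  have hmul : Matrix.fromBlocks A B 1 D * Matrix.fromBlocks 1 (1 - D) 0 1 =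
      Matrix.fromBlocks A (A * (1 - D) + B) 1 1 := by
    simp [Matrix.fromBlocks_multiply]
  calc (Matrix.fromBlocks A B 1 D).det
    _ = (Matrix.fromBlocks A B 1 D * Matrix.fromBlocks 1 (1 - D) 0 1).det := by simp
    _ = (A * D - B).det := by
        rw [hmul, Matrix.det_fromBlocks_one₂₂]
        congr 1
        noncomm_ring

theorem det_mixedMatrix_eq_det_mul (Y : Matrix μ τ S) (Z : Matrix τ ν S) (i : α → μ) (j : α → ν)
    {c : α → τ} {e : κ → τ} (h : Function.Bijective (Sum.elim c e)) :
    (mixedMatrix Y Z i c c j e).det = ((Y * Z).submatrix i j).det := by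
  have hc : Function.Injective c := h.injective.comp Sum.inl_injective
  have he : Function.Injective e := h.injective.comp Sum.inr_injective
  have hce : ∀ x y, c x ≠ e y := fun x y hxy => Sum.inl_ne_inr (h.injective hxy)
  have hblocks : mixedMatrix Y Z i c c j e =
      Matrix.fromBlocks (Matrix.fromBlocks (Y.submatrix i c) 0 1 (Z.submatrix c j))
        (Matrix.fromRows (Y.submatrix i e) 0) (Matrix.fromCols 0 (Z.submatrix e j)) 1 := by
    ext ((x | x) | x) ((y | y) | y) <;>
      simp [mixedMatrix, mixedRow, mixedCol, Matrix.one_apply, hc.eq_iff, he.eq_iff, hce,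
        (hce _ _).symm]
  have hsub : Matrix.fromBlocks (Y.submatrix i c) 0 1 (Z.submatrix c j) -
      Matrix.fromRows (Y.submatrix i e) 0 * Matrix.fromCols 0 (Z.submatrix e j) =
      Matrix.fromBlocks (Y.submatrix i c) (-(Y.submatrix i e * Z.submatrix e j)) 1
        (Z.submatrix c j) := by
    rw [Matrix.fromRows_mul_fromCols, sub_eq_add_neg, Matrix.fromBlocks_neg,
      Matrix.fromBlocks_add]
    simp
  rw [hblocks, Matrix.det_fromBlocks_one₂₂, hsub, det_fromBlocks_one₂₁, sub_neg_eq_add,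
    submatrix_mul_of_bijective Y Z i j h]

end MixedMatrix

section LeadingMonomial

open MvPolynomial

variable {R : Type u} [CommRing R] {σ : Type v} {Γ : Type*} [AddCommMonoid Γ] [LinearOrder Γ]

/-- `e` is the unique monomial of `g` of largest weight, and has coefficient one. The weights are
not assumed to separate monomials, so that a polynomial need not have a leading monomial. -/
def HasLead (w : σ → Γ) (g : MvPolynomial σ R) (e : σ →₀ ℕ) : Prop :=
  coeff e g = 1 ∧
    ∀ e', coeff e' g ≠ 0 → e' ≠ e → Finsupp.weight w e' < Finsupp.weight w e

variable {w : σ → Γ}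

theorem hasLead_monomial_one (e : σ →₀ ℕ) : HasLead w (monomial e (1 : R)) e := by
  classical
  refine ⟨by simp, fun e' he' hne => ?_⟩
  rw [coeff_monomial, if_neg hne.symm] at he'
  exact absurd rfl he'

theorem HasLead.weight_le {g : MvPolynomial σ R} {e e' : σ →₀ ℕ} (h : HasLead w g e)
    (he' : coeff e' g ≠ 0) : Finsupp.weight w e' ≤ Finsupp.weight w e := by
  by_cases hne : e' = e
  · rw [hne]
  · exact (h.2 e' he' hne).le

theorem hasLead_sum_monomial {ι : Type*} [Fintype ι] {E : ι → σ →₀ ℕ} {a : ι → R} {s₀ : ι}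
    (hone : a s₀ = 1)
    (hlt : ∀ s, s ≠ s₀ → a s ≠ 0 → Finsupp.weight w (E s) < Finsupp.weight w (E s₀)) :
    HasLead w (∑ s, monomial (E s) (a s)) (E s₀) := by
  classical
  constructor
  · rw [coeff_sum, Fintype.sum_eq_single s₀]
    · simp [hone]
    · intro s hs
      rw [coeff_monomial, ite_eq_right_iff]
      intro hE
      by_contra hne
      exact (hlt s hs hne).ne (congrArg _ hE)
  · intro e' he' hne
    rw [coeff_sum] at he'
    obtain ⟨s, _, hs⟩ := Finset.exists_ne_zero_of_sum_ne_zero he'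
    rw [coeff_monomial, ite_ne_right_iff] at hs
    obtain ⟨rfl, hs⟩ := hs
    exact hlt s (fun h => hne (congrArg E h)) hs

theorem hasLead_det_of_monomial {ι : Type*} [Fintype ι] [DecidableEq ι] {E : ι → ι → σ →₀ ℕ}
    {a : ι → ι → R} (hone : ∀ x, a x x = 1)
    (hlt : ∀ π : Equiv.Perm ι, π ≠ 1 → (∀ x, a (π x) x ≠ 0) →
      ∑ x, Finsupp.weight w (E (π x) x) < ∑ x, Finsupp.weight w (E x x)) :
    HasLead w (Matrix.of fun x y => monomial (E x y) (a x y)).det (∑ x, E x x) := by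
  have hdet : (Matrix.of fun x y => monomial (E x y) (a x y)).det = ∑ π : Equiv.Perm ι,
      monomial (∑ x, E (π x) x) ((Equiv.Perm.sign π : ℤ) * ∏ x, a (π x) x) := by
    rw [Matrix.det_apply]
    refine Finset.sum_congr rfl fun π _ => ?_
    simp only [Matrix.of_apply]
    rw [← monomial_sum_prod, Units.smul_def, zsmul_eq_mul, ← C_mul_monomial, map_intCast]
  rw [hdet]
  refine hasLead_sum_monomial (s₀ := 1) (by simp [hone]) fun π hπ ha => ?_
  simp only [map_sum]
  exact hlt π hπ fun x hx => ha <| by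
    rw [Finset.prod_eq_zero (f := fun x => a (π x) x) (Finset.mem_univ x) hx, mul_zero]

theorem mem_of_forall_monomial_one_mem {T : Submodule R (MvPolynomial σ R)}
    {g : MvPolynomial σ R} (h : ∀ e ∈ g.support, monomial e 1 ∈ T) : g ∈ T := by
  rw [g.as_sum]
  refine T.sum_mem fun e he => ?_
  simpa [smul_monomial] using T.smul_mem (coeff e g) (h e he)

theorem monomial_one_mem_of_hasLead [WellFoundedLT Γ] {T : Submodule R (MvPolynomial σ R)}
    (h : ∀ e, monomial e 1 ∉ T → ∃ q ∈ T, HasLead w q e) (e : σ →₀ ℕ) : monomial e 1 ∈ T := by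
  classical
  induction hN : Finsupp.weight w e using WellFoundedLT.induction generalizing e with
  | ind N ih =>
    subst hN
    by_contra he
    obtain ⟨q, hq, hlead⟩ := h e he
    have hrest : q - monomial e 1 ∈ T := mem_of_forall_monomial_one_mem fun e' he' => by
      rw [mem_support_iff, coeff_sub] at he'
      have hne : e' ≠ e := by
        rintro rfl
        simp [hlead.1] at he'
      rw [coeff_monomial, if_neg hne.symm, sub_zero] at he'
      exact ih _ (hlead.2 e' he' hne) e' rfl
    exact he (by simpa using T.sub_mem hq hrest)

variable [IsOrderedCancelAddMonoid Γ]

theorem HasLead.eq_and_eq_of_weight_le {g g' : MvPolynomial σ R} {e e' f f' : σ →₀ ℕ}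
    (h : HasLead w g e) (h' : HasLead w g' e') (hf : coeff f g ≠ 0) (hf' : coeff f' g' ≠ 0)
    (hle : Finsupp.weight w (e + e') ≤ Finsupp.weight w (f + f')) : f = e ∧ f' = e' := by
  rw [map_add, map_add] at hle
  constructor <;> by_contra hne <;> refine hle.not_gt ?_
  · exact add_lt_add_of_lt_of_le (h.2 f hf hne) (h'.weight_le hf')
  · exact add_lt_add_of_le_of_lt (h.weight_le hf) (h'.2 f' hf' hne)

theorem HasLead.mul {g g' : MvPolynomial σ R} {e e' : σ →₀ ℕ} (h : HasLead w g e)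
    (h' : HasLead w g' e') : HasLead w (g * g') (e + e') := by
  classical
  constructor
  · rw [coeff_mul, Finset.sum_eq_single (e, e')]
    · simp [h.1, h'.1]
    · rintro ⟨f, f'⟩ hff' hne
      by_contra hcoeff
      obtain ⟨rfl, rfl⟩ := h.eq_and_eq_of_weight_le h' (left_ne_zero_of_mul hcoeff)
        (right_ne_zero_of_mul hcoeff) (by rw [Finset.HasAntidiagonal.mem_antidiagonal.1 hff'])
      exact hne rfl
    · simp
  · intro d hd hne
    rw [coeff_mul] at hd
    obtain ⟨⟨f, f'⟩, hff', hcoeff⟩ := Finset.exists_ne_zero_of_sum_ne_zero hd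
    obtain rfl : f + f' = d := by simpa using hff'
    by_contra hle
    obtain ⟨rfl, rfl⟩ := h.eq_and_eq_of_weight_le h' (left_ne_zero_of_mul hcoeff)
      (right_ne_zero_of_mul hcoeff) (not_lt.1 hle)
    exact hne rfl

theorem HasLead.prod {ι : Type*} {s : Finset ι} {g : ι → MvPolynomial σ R} {e : ι → σ →₀ ℕ}
    (h : ∀ i ∈ s, HasLead w (g i) (e i)) : HasLead w (∏ i ∈ s, g i) (∑ i ∈ s, e i) := by
  classical
  induction s using Finset.induction_on with
  | empty => simpa using hasLead_monomial_one (R := R) 0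
  | insert i s hi ih =>
    rw [Finset.prod_insert hi, Finset.sum_insert hi]
    exact (h i (Finset.mem_insert_self _ _)).mul
      (ih fun j hj => h j (Finset.mem_insert_of_mem hj))

theorem HasLead.pow {g : MvPolynomial σ R} {e : σ →₀ ℕ} (h : HasLead w g e) (q : ℕ) :
    HasLead w (g ^ q) (q • e) := by
  simpa using HasLead.prod (s := Finset.range q) fun _ _ => h

theorem HasLead.monomial_sub_mul {g : MvPolynomial σ R} {e₀ e : σ →₀ ℕ} (h : HasLead w g e₀)
    (hle : e₀ ≤ e) : HasLead w (monomial (e - e₀) 1 * g) e := by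
  simpa [tsub_add_cancel_of_le hle] using (hasLead_monomial_one (e - e₀)).mul h

theorem exists_reduced_representative [WellFoundedLT Γ] {I : Ideal (MvPolynomial σ R)}
    {standard : (σ →₀ ℕ) → Prop}
    (h : ∀ e, ¬ standard e → ∃ q ∈ I, ∃ e₀ ≤ e, HasLead w q e₀) (g : MvPolynomial σ R) :
    ∃ g', g - g' ∈ I ∧ ∀ e ∈ g'.support, standard e := by
  let T : Submodule R (MvPolynomial σ R) :=
    I.restrictScalars R ⊔ restrictSupport R {e | standard e}
  have hT : ∀ e, monomial e 1 ∉ T → ∃ q ∈ T, HasLead w q e := by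
    intro e he
    obtain ⟨q, hq, e₀, hle, hlead⟩ := h e fun hst => he <| Submodule.mem_sup_right <|
      (mem_restrictSupport_iff R).2 fun e' he' =>
        Finset.mem_singleton.1 (support_monomial_subset he') ▸ hst
    exact ⟨_, Submodule.mem_sup_left (I.mul_mem_left _ hq), hlead.monomial_sub_mul hle⟩
  obtain ⟨x, hx, y, hy, rfl⟩ := Submodule.mem_sup.1
    (mem_of_forall_monomial_one_mem fun e _ => monomial_one_mem_of_hasLead hT e : g ∈ T)
  exact ⟨y, by simpa using hx, fun e he => (mem_restrictSupport_iff R).1 hy he⟩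

theorem frobTrace_pow_eq_one {K : Type u} [Field K] [Fintype σ] (p : ℕ) [Fact p.Prime]
    {φ : K →+ K} (hφ : φ 1 = 1) (hw : ∀ v, 0 ≤ w v) {f : MvPolynomial σ K}
    (hf : HasLead w f (Finsupp.equivFunOnFinite.symm fun _ => 1)) :
    frobTrace p φ (f ^ (p - 1)) = 1 := by
  classical
  have hsocle : (p - 1) • Finsupp.equivFunOnFinite.symm (fun _ => 1) = frobShift p (0 : σ →₀ ℕ) :=
    Finsupp.ext fun v => by simp
  have hlead : HasLead w (f ^ (p - 1)) (frobShift p 0) := hsocle ▸ hf.pow (p - 1)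
  ext e
  rw [coeff_frobTrace, coeff_one]
  split_ifs with he
  · rw [← he, hlead.1, hφ]
  · suffices hzero : coeff (frobShift p e) (f ^ (p - 1)) = 0 by rw [hzero, map_zero]
    by_contra hne
    have hlt := hlead.2 _ hne fun h => he (frobShift_injective p h).symm
    rw [frobShift, frobShift, smul_zero, add_zero, map_add] at hlt
    refine hlt.not_ge (le_add_of_nonneg_right ?_)
    rw [Finsupp.weight_apply]
    exact Finsupp.sum_nonneg fun v _ => nsmul_nonneg (hw v) _

end LeadingMonomial

section Assignment

theorem sum_perm_mul_lt_sum_mul {ι : Type*} [Fintype ι] [LinearOrder ι] [WellFoundedLT ι]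
    {x y : ι → ℕ} (hx : StrictMono x) (hy : StrictMono y) {s : Equiv.Perm ι} (hs : s ≠ 1) :
    ∑ l, x (s l) * y l < ∑ l, x l * y l := by
  have hxy : Monovary x y := fun _ _ h => hx.monotone (hy.lt_iff_lt.1 h).le
  refine hxy.sum_comp_perm_mul_lt_sum_mul_iff.2 fun hmono => hs ?_
  have hs_mono : StrictMono s := fun l l' hl =>
    (hx.le_iff_le.1 (hmono (hy hl))).lt_of_ne (s.injective.ne hl.ne)
  have hid : ⇑s = id :=
    (StrictMono.range_inj hs_mono strictMono_id).1 (by rw [s.range_eq_univ, Set.range_id])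
  exact Equiv.ext (congrFun hid)

theorem sum_perm_lt_or_eq_of_potential {ι : Type*} [Fintype ι] {L : ι → ι → ℕ} {α β : ι → ℤ}
    (hdiag : ∀ x, L x x = α x + β x) (π : Equiv.Perm ι) (hle : ∀ x, L (π x) x ≤ α (π x) + β x) :
    ∑ x, L (π x) x < ∑ x, L x x ∨
      ∑ x, L (π x) x = ∑ x, L x x ∧ ∀ x, L (π x) x = α (π x) + β x := by
  have hsum : ((∑ x, L x x : ℕ) : ℤ) = ∑ x, (α (π x) + β x) := by
    simp only [Nat.cast_sum, hdiag, Finset.sum_add_distrib, Equiv.sum_comp π α]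
  by_cases htight : ∀ x, L (π x) x = α (π x) + β x
  · refine Or.inr ⟨Nat.cast_injective (R := ℤ) ?_, htight⟩
    rw [hsum, Nat.cast_sum, Finset.sum_congr rfl fun x _ => htight x]
  · obtain ⟨x, hx⟩ := not_forall.1 htight
    refine Or.inl (Nat.cast_lt (α := ℤ).1 ?_)
    rw [hsum, Nat.cast_sum]
    exact Finset.sum_lt_sum (fun x _ => hle x) ⟨x, Finset.mem_univ x, (hle x).lt_of_ne hx⟩

/-- The block of the index set of a mixed matrix that contains an index, where the indices of the
identity block are separate blocks. -/
def blockLabel {α β κ : Type*} : (α ⊕ β) ⊕ κ → (Unit ⊕ Unit) ⊕ κ :=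
  Sum.map (Sum.map (fun _ => ()) fun _ => ()) id

theorem exists_eq_sumCongr_of_blockLabel_eq {α β κ : Type*} [Finite α] [Finite β] [Finite κ]
    {π : Equiv.Perm ((α ⊕ β) ⊕ κ)} (h : ∀ x, blockLabel (π x) = blockLabel x) :
    ∃ s s', π = Equiv.Perm.sumCongr (Equiv.Perm.sumCongr s s') 1 := by
  obtain ⟨⟨π₁, π₂⟩, rfl⟩ := Equiv.Perm.mem_sumCongrHom_range_of_perm_mapsTo_inl (σ := π) <| by
    rintro _ ⟨x, rfl⟩
    rcases hx : π (Sum.inl x) with y | y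
    · exact ⟨y, rfl⟩
    · simpa [hx, blockLabel] using h (Sum.inl x)
  obtain ⟨⟨s, s'⟩, rfl⟩ := Equiv.Perm.mem_sumCongrHom_range_of_perm_mapsTo_inl (σ := π₁) <| by
    rintro _ ⟨x, rfl⟩
    rcases hx : π₁ (Sum.inl x) with y | y
    · exact ⟨y, rfl⟩
    · simpa [hx, blockLabel] using h (Sum.inl (Sum.inl x))
  refine ⟨s, s', ?_⟩
  have hπ₂ : π₂ = 1 := Equiv.ext fun x => by simpa [blockLabel] using h (Sum.inr x)
  rw [hπ₂]
  rfl

end Assignment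

section DiagonalWeight

open MvPolynomial

variable {m t n : ℕ}

/-- Weights of the variables for which the leading monomials of the minors of `Y`, of `Z` and of the
relevant mixed matrices are the products of their diagonal entries. The index that `Y` and `Z` share
dominates. -/
def diagWeight (m t n : ℕ) : (Fin m × Fin t) ⊕ (Fin t × Fin n) → ℕ ×ₗ ℕ :=
  Sum.elim (fun x => toLex (2 * x.2, x.1 * x.2)) (fun x => toLex (2 * x.1, x.1 * x.2))

/-- The exponents of the entries of the block matrix with rows `(0, Y)` and `(Z, 1)`. -/
noncomputable def blockExponent : Fin m ⊕ Fin t → Fin n ⊕ Fin t →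
    ((Fin m × Fin t) ⊕ (Fin t × Fin n) →₀ ℕ)
  | Sum.inl i, Sum.inr c => Finsupp.single (Sum.inl (i, c)) 1
  | Sum.inr c, Sum.inl j => Finsupp.single (Sum.inr (c, j)) 1
  | _, _ => 0

/-- The coefficients of the entries of the block matrix with rows `(0, Y)` and `(Z, 1)`. -/
def blockCoeff (K : Type u) [Field K] : Fin m ⊕ Fin t → Fin n ⊕ Fin t → K
  | Sum.inl _, Sum.inl _ => 0
  | Sum.inr c, Sum.inr c' => if c = c' then 1 else 0
  | _, _ => 1

theorem fromBlocks_eq_monomial (K : Type u) [Field K] (x : Fin m ⊕ Fin t) (y : Fin n ⊕ Fin t) :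
    Matrix.fromBlocks 0 (matY K m t n) (matZ K m t n) 1 x y =
      monomial (blockExponent x y) (blockCoeff K x y) := by
  rcases x with x | x <;> rcases y with y | y
  · simp [blockExponent, blockCoeff]
  · simp [blockExponent, blockCoeff, matY, X]
  · simp [blockExponent, blockCoeff, matZ, X]
  · simp only [Matrix.fromBlocks_apply₂₂, blockExponent, blockCoeff, Matrix.one_apply]
    split_ifs <;> simp

/-- The dominant part of the weights of the entries of the block matrix. -/
def blockLinear : Fin m ⊕ Fin t → Fin n ⊕ Fin t → ℕ
  | Sum.inl _, Sum.inr c => 2 * c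
  | Sum.inr c, Sum.inl _ => 2 * c
  | _, _ => 0

/-- The second part of the weights of the entries of the block matrix. -/
def blockQuadratic : Fin m ⊕ Fin t → Fin n ⊕ Fin t → ℕ
  | Sum.inl i, Sum.inr c => i * c
  | Sum.inr c, Sum.inl j => c * j
  | _, _ => 0

theorem weight_blockExponent (x : Fin m ⊕ Fin t) (y : Fin n ⊕ Fin t) :
    Finsupp.weight (diagWeight m t n) (blockExponent x y) =
      toLex (blockLinear x y, blockQuadratic x y) := by
  rcases x with x | x <;> rcases y with y | y <;>
    simp [blockExponent, blockLinear, blockQuadratic, Finsupp.weight_single, diagWeight] <;> rfl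

theorem sum_toLex_prod {ι : Type*} (s : Finset ι) (f g : ι → ℕ) :
    ∑ x ∈ s, toLex (f x, g x) = (toLex (∑ x ∈ s, f x, ∑ x ∈ s, g x) : ℕ ×ₗ ℕ) := by
  rw [prod_mk_sum]
  exact (map_sum (toLexAddEquiv (ℕ × ℕ)) _ s).symm

variable {a b k : ℕ} (i : Fin a → Fin m) (c : Fin a → Fin t) (d : Fin b → Fin t)
  (j : Fin b → Fin n) (hk : k ≤ t)

/-- The row part of a linear programming certificate for `blockLinear`. -/
def rowPotential : (Fin a ⊕ Fin b) ⊕ Fin k → ℤ :=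
  Sum.elim (Sum.elim (fun _ => 2 * k - 1) fun l => 2 * (d l : ℕ) - (2 * k - 1)) fun _ => 0

/-- The column part of a linear programming certificate for `blockLinear`. -/
def colPotential : (Fin a ⊕ Fin b) ⊕ Fin k → ℤ :=
  Sum.elim (Sum.elim (fun l => 2 * (c l : ℕ) - (2 * k - 1)) fun _ => 2 * k - 1) fun _ => 0

variable {i c d j}

theorem blockLinear_diag (x : (Fin a ⊕ Fin b) ⊕ Fin k) :
    (blockLinear (mixedRow i d (Fin.castLE hk) x) (mixedCol c j (Fin.castLE hk) x) : ℤ) =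
      rowPotential d x + colPotential c x := by
  rcases x with (x | x) | x <;>
    simp [mixedRow, mixedCol, blockLinear, rowPotential, colPotential]

theorem blockLinear_le (K : Type u) [Field K] (hc : ∀ l, k ≤ (c l : ℕ)) (hd : ∀ l, k ≤ (d l : ℕ))
    {x y : (Fin a ⊕ Fin b) ⊕ Fin k}
    (h : blockCoeff K (mixedRow i d (Fin.castLE hk) x) (mixedCol c j (Fin.castLE hk) y) ≠ 0) :
    (blockLinear (mixedRow i d (Fin.castLE hk) x) (mixedCol c j (Fin.castLE hk) y) : ℤ) ≤
        rowPotential d x + colPotential c y ∧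
      ((blockLinear (mixedRow i d (Fin.castLE hk) x) (mixedCol c j (Fin.castLE hk) y) : ℤ) =
        rowPotential d x + colPotential c y → blockLabel x = blockLabel y) := by
  rcases x with (x | x) | x <;> rcases y with (y | y) | y <;>
    simp only [mixedRow, mixedCol, Sum.elim_inl, Sum.elim_inr, Function.comp, blockCoeff, ne_eq,
      ite_eq_right_iff, one_ne_zero, imp_false, not_not, not_true_eq_false] at h <;>
    simp only [mixedRow, mixedCol, blockLinear, rowPotential, colPotential, blockLabel,
      Sum.elim_inl, Sum.elim_inr, Function.comp, Sum.map_inl, Sum.map_inr, id, Fin.val_castLE,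
      Fin.ext_iff] at h ⊢
  case inl.inr.inl.inl => have := hc y; omega
  case inl.inr.inr => have := hd x; omega
  case inr.inl.inl => have := hc y; omega
  case inr.inr => exact ⟨by simp, fun _ => congrArg Sum.inr (Fin.ext h)⟩
  all_goals simp; try omega

theorem sum_blockLinear_lt_or_eq (K : Type u) [Field K] (hc : ∀ l, k ≤ (c l : ℕ))
    (hd : ∀ l, k ≤ (d l : ℕ)) (π : Equiv.Perm ((Fin a ⊕ Fin b) ⊕ Fin k))
    (hπ : ∀ x, blockCoeff K (mixedRow i d (Fin.castLE hk) (π x))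
      (mixedCol c j (Fin.castLE hk) x) ≠ 0) :
    ∑ x, blockLinear (mixedRow i d (Fin.castLE hk) (π x)) (mixedCol c j (Fin.castLE hk) x) <
        ∑ x, blockLinear (mixedRow i d (Fin.castLE hk) x) (mixedCol c j (Fin.castLE hk) x) ∨
      ∑ x, blockLinear (mixedRow i d (Fin.castLE hk) (π x)) (mixedCol c j (Fin.castLE hk) x) =
        ∑ x, blockLinear (mixedRow i d (Fin.castLE hk) x) (mixedCol c j (Fin.castLE hk) x) ∧
      ∀ x, blockLabel (π x) = blockLabel x := by
  let L x y := blockLinear (mixedRow i d (Fin.castLE hk) x) (mixedCol c j (Fin.castLE hk) y)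
  rcases sum_perm_lt_or_eq_of_potential (L := L) (blockLinear_diag hk) π
    fun x => (blockLinear_le hk K hc hd (hπ x)).1 with hlt | ⟨heq, htight⟩
  · exact Or.inl hlt
  · exact Or.inr ⟨heq, fun x => (blockLinear_le hk K hc hd (hπ x)).2 (htight x)⟩

theorem sum_blockQuadratic_sumCongr (s : Equiv.Perm (Fin a)) (s' : Equiv.Perm (Fin b)) :
    ∑ x, blockQuadratic
        (mixedRow i d (Fin.castLE hk) (Equiv.Perm.sumCongr (Equiv.Perm.sumCongr s s') 1 x))
        (mixedCol c j (Fin.castLE hk) x) =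
      ∑ l, (i (s l) : ℕ) * c l + ∑ l, (d (s' l) : ℕ) * j l := by
  simp [Fintype.sum_sum_type, mixedRow, mixedCol, blockQuadratic]

theorem sum_blockQuadratic_lt (hi : StrictMono i) (hc : StrictMono c) (hd : StrictMono d)
    (hj : StrictMono j) {π : Equiv.Perm ((Fin a ⊕ Fin b) ⊕ Fin k)} (hπ : π ≠ 1)
    (hlabel : ∀ x, blockLabel (π x) = blockLabel x) :
    ∑ x, blockQuadratic (mixedRow i d (Fin.castLE hk) (π x)) (mixedCol c j (Fin.castLE hk) x) <
      ∑ x, blockQuadratic (mixedRow i d (Fin.castLE hk) x) (mixedCol c j (Fin.castLE hk) x) := by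
  obtain ⟨s, s', rfl⟩ := exists_eq_sumCongr_of_blockLabel_eq hlabel
  have hone := sum_blockQuadratic_sumCongr (i := i) (c := c) (d := d) (j := j) hk 1 1
  simp only [Equiv.Perm.sumCongr_one, Equiv.Perm.one_apply] at hone
  rw [sum_blockQuadratic_sumCongr, hone]
  have hlt {s : Equiv.Perm (Fin a)} (hs : s ≠ 1) : _ < ∑ l, (i l : ℕ) * c l :=
    sum_perm_mul_lt_sum_mul hi hc hs
  have hlt' {s' : Equiv.Perm (Fin b)} (hs' : s' ≠ 1) : _ < ∑ l, (d l : ℕ) * j l :=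
    sum_perm_mul_lt_sum_mul hd hj hs'
  by_cases hs : s = 1 <;> by_cases hs' : s' = 1
  · exact absurd (by rw [hs, hs', Equiv.Perm.sumCongr_one, Equiv.Perm.sumCongr_one]) hπ
  · simpa [hs] using hlt' hs'
  · simpa [hs'] using hlt hs
  · exact add_lt_add (hlt hs) (hlt' hs')

variable (i c d j)

/-- The exponent of the product of the diagonal entries of a mixed matrix outside its identity
block. -/
noncomputable def chainExponent : (Fin m × Fin t) ⊕ (Fin t × Fin n) →₀ ℕ :=
  ∑ l, Finsupp.single (Sum.inl (i l, c l)) 1 + ∑ l, Finsupp.single (Sum.inr (d l, j l)) 1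

variable {i c d j}

theorem hasLead_det_mixedMatrix (K : Type u) [Field K] (hi : StrictMono i) (hc : StrictMono c)
    (hd : StrictMono d) (hj : StrictMono j) (hck : ∀ l, k ≤ (c l : ℕ))
    (hdk : ∀ l, k ≤ (d l : ℕ)) :
    HasLead (diagWeight m t n)
      (mixedMatrix (matY K m t n) (matZ K m t n) i c d j (Fin.castLE hk)).det
      (chainExponent i c d j) := by
  have hentry : mixedMatrix (matY K m t n) (matZ K m t n) i c d j (Fin.castLE hk) =
      Matrix.of fun x y => monomial
        (blockExponent (mixedRow i d (Fin.castLE hk) x) (mixedCol c j (Fin.castLE hk) y))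
        (blockCoeff K (mixedRow i d (Fin.castLE hk) x) (mixedCol c j (Fin.castLE hk) y)) :=
    Matrix.ext fun x y => fromBlocks_eq_monomial K _ _
  have hdiag : ∑ x, blockExponent (mixedRow i d (Fin.castLE hk) x)
      (mixedCol c j (Fin.castLE hk) x) = chainExponent i c d j := by
    simp [chainExponent, mixedRow, mixedCol, blockExponent, Fintype.sum_sum_type]
  rw [hentry, ← hdiag]
  refine hasLead_det_of_monomial ?_ fun π hπ hcoeff => ?_
  · rintro ((_ | _) | _) <;> simp [mixedRow, mixedCol, blockCoeff]
  · simp only [weight_blockExponent, sum_toLex_prod, Prod.Lex.toLex_lt_toLex]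
    exact (sum_blockLinear_lt_or_eq hk K hck hdk π hcoeff).imp_right fun h =>
      ⟨h.1, sum_blockQuadratic_lt hk hi hc hd hj hπ h.2⟩

end DiagonalWeight

section SplittingPolynomialLead

open MvPolynomial

variable {m t n : ℕ}

theorem det_mixedMatrix_left {S : Type u} [CommRing S] {μ τ ν α β κ : Type*} [DecidableEq τ]
    [Fintype α] [DecidableEq α] [Fintype β] [DecidableEq β] [Fintype κ] [DecidableEq κ] [IsEmpty β]
    [IsEmpty κ] (Y : Matrix μ τ S) (Z : Matrix τ ν S) (i : α → μ) (c : α → τ) (d : β → τ)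
    (j : β → ν) (e : κ → τ) : (mixedMatrix Y Z i c d j e).det = (Y.submatrix i c).det := by
  rw [← Matrix.det_submatrix_equiv_self
    ((Equiv.sumEmpty α β).symm.trans (Equiv.sumEmpty (α ⊕ β) κ).symm)]
  rfl

theorem det_mixedMatrix_right {S : Type u} [CommRing S] {μ τ ν α β κ : Type*} [DecidableEq τ]
    [Fintype α] [DecidableEq α] [Fintype β] [DecidableEq β] [Fintype κ] [DecidableEq κ] [IsEmpty α]
    [IsEmpty κ] (Y : Matrix μ τ S) (Z : Matrix τ ν S) (i : α → μ) (c : α → τ) (d : β → τ)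
    (j : β → ν) (e : κ → τ) : (mixedMatrix Y Z i c d j e).det = (Z.submatrix d j).det := by
  rw [← Matrix.det_submatrix_equiv_self
    ((Equiv.emptySum α β).symm.trans (Equiv.sumEmpty (α ⊕ β) κ).symm)]
  rfl

theorem hasLead_det_submatrix_matY (K : Type u) [Field K] {a : ℕ} {i : Fin a → Fin m}
    {c : Fin a → Fin t} (hi : StrictMono i) (hc : StrictMono c) :
    HasLead (diagWeight m t n) ((matY K m t n).submatrix i c).det
      (∑ l, Finsupp.single (Sum.inl (i l, c l)) 1) := by
  have h := hasLead_det_mixedMatrix (Nat.zero_le t) K hi hc (d := Fin.elim0)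
    (j := (Fin.elim0 : Fin 0 → Fin n)) (fun l => l.elim0) (fun l => l.elim0)
    (fun _ => Nat.zero_le _) fun _ => Nat.zero_le _
  rw [det_mixedMatrix_left] at h
  simpa [chainExponent] using h

theorem hasLead_det_submatrix_matZ (K : Type u) [Field K] {b : ℕ} {d : Fin b → Fin t}
    {j : Fin b → Fin n} (hd : StrictMono d) (hj : StrictMono j) :
    HasLead (diagWeight m t n) ((matZ K m t n).submatrix d j).det
      (∑ l, Finsupp.single (Sum.inr (d l, j l)) 1) := by
  have h := hasLead_det_mixedMatrix (Nat.zero_le t) K (c := Fin.elim0)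
    (i := (Fin.elim0 : Fin 0 → Fin m)) (fun l => l.elim0) (fun l => l.elim0) hd hj
    (fun _ => Nat.zero_le _) fun _ => Nat.zero_le _
  rw [det_mixedMatrix_right] at h
  simpa [chainExponent] using h

theorem hasLead_prod_diagMinor_matY (K : Type u) [Field K] :
    HasLead (diagWeight m t n) (∏ d, diagMinor (matY K m t n) d)
      (∑ d : Fin m, ∑ l : Fin (min t (m - d)),
        Finsupp.single (Sum.inl (⟨d + l, by omega⟩, Fin.castLE (min_le_left _ _) l)) 1) :=
  HasLead.prod fun _ _ => hasLead_det_submatrix_matY K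
    (fun _ _ h => by simpa using h) (Fin.strictMono_castLE _)

theorem hasLead_prod_diagMinor_matZ (K : Type u) [Field K] :
    HasLead (diagWeight m t n) (∏ d, diagMinor (matZ K m t n).transpose d)
      (∑ d : Fin n, ∑ l : Fin (min t (n - d)),
        Finsupp.single (Sum.inr (Fin.castLE (min_le_left _ _) l, ⟨d + l, by omega⟩)) 1) :=
  HasLead.prod fun _ _ => by
    rw [diagMinor, ← Matrix.det_transpose]
    exact hasLead_det_submatrix_matZ K (Fin.strictMono_castLE _) fun _ _ h => by simpa using h

theorem bijective_sumElim_shift_castLE (k : Fin t) : Function.Bijective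
    (Sum.elim (fun l : Fin k => (⟨t - k + l, by omega⟩ : Fin t)) (Fin.castLE (t.sub_le k))) := by
  rw [Fintype.bijective_iff_injective_and_card]
  refine ⟨?_, by simp⟩
  rintro (x | x) (y | y) h <;>
    simp only [Sum.elim_inl, Sum.elim_inr, Fin.ext_iff, Fin.val_castLE] at h
  case inl.inl => exact congrArg Sum.inl (Fin.ext (by omega))
  case inr.inr => exact congrArg Sum.inr (Fin.ext h)
  all_goals omega

theorem hasLead_productMinor (K : Type u) [Field K] (hm : t ≤ m) (hn : t ≤ n) (k : Fin t) :
    HasLead (diagWeight m t n) (productMinor hm hn (matY K m t n) (matZ K m t n) k)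
      (chainExponent (Fin.castLE (k.2.le.trans hm)) (fun l : Fin k => ⟨t - k + l, by omega⟩)
        (fun l : Fin k => ⟨t - k + l, by omega⟩) (Fin.castLE (k.2.le.trans hn))) := by
  rw [productMinor, ← det_mixedMatrix_eq_det_mul _ _ _ _ (bijective_sumElim_shift_castLE k)]
  exact hasLead_det_mixedMatrix _ K (Fin.strictMono_castLE _) (fun _ _ h => by simpa using h)
    (fun _ _ h => by simpa using h) (Fin.strictMono_castLE _) (by simp) (by simp)

theorem sum_single_diagonals {τ : Type*} {v : Fin m → Fin t → τ} (hv : Function.Injective2 v)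
    (i : Fin m) (c : Fin t) :
    (∑ d : Fin m, ∑ l : Fin (min t (m - d)),
      Finsupp.single (v ⟨d + l, by omega⟩ (Fin.castLE (min_le_left _ _) l)) 1 : τ →₀ ℕ) (v i c) =
        if (c : ℕ) ≤ i then 1 else 0 := by
  classical
  simp only [Finsupp.finsetSum_apply, Finsupp.single_apply, hv.eq_iff, Fin.ext_iff,
    Fin.val_castLE]
  split_ifs with h
  · rw [Fintype.sum_eq_single ⟨i - c, by omega⟩, Fintype.sum_eq_single ⟨c, by dsimp only; omega⟩,
      if_pos ⟨Nat.sub_add_cancel h, rfl⟩]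
    · exact fun l hl => if_neg fun hcell => hl (Fin.ext hcell.2)
    · refine fun d hd => Finset.sum_eq_zero fun l _ => if_neg fun hcell => hd (Fin.ext ?_)
      dsimp only
      omega
  · refine Finset.sum_eq_zero fun d _ => Finset.sum_eq_zero fun l _ => if_neg fun hcell => ?_
    omega

theorem sum_single_corners {τ : Type*} (hm : t ≤ m) {v : Fin m → Fin t → τ}
    (hv : Function.Injective2 v) (i : Fin m) (c : Fin t) :
    (∑ k : Fin t, ∑ l : Fin k,
      Finsupp.single (v (Fin.castLE (k.2.le.trans hm) l) ⟨t - k + l, by omega⟩) 1 : τ →₀ ℕ)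
        (v i c) = if (c : ℕ) ≤ i then 0 else 1 := by
  classical
  simp only [Finsupp.finsetSum_apply, Finsupp.single_apply, hv.eq_iff, Fin.ext_iff,
    Fin.val_castLE]
  split_ifs with h
  · refine Finset.sum_eq_zero fun d _ => Finset.sum_eq_zero fun l _ => if_neg fun hcell => ?_
    omega
  · rw [Fintype.sum_eq_single ⟨t - (c - i), by omega⟩,
      Fintype.sum_eq_single ⟨i, by dsimp only; omega⟩, if_pos ⟨rfl, by dsimp only; omega⟩]
    · exact fun l hl => if_neg fun hcell => hl (Fin.ext hcell.1)
    · refine fun d hd => Finset.sum_eq_zero fun l _ => if_neg fun hcell => hd (Fin.ext ?_)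
      dsimp only
      omega

theorem hasLead_splittingPoly (K : Type u) [Field K] (hm : t ≤ m) (hn : t ≤ n) :
    HasLead (diagWeight m t n) (splittingPoly hm hn (matY K m t n) (matZ K m t n))
      (Finsupp.equivFunOnFinite.symm fun _ => 1) := by
  convert ((hasLead_prod_diagMinor_matY K).mul (hasLead_prod_diagMinor_matZ K)).mul
    (HasLead.prod (s := Finset.univ) fun k _ => hasLead_productMinor K hm hn k) using 1
  · rfl
  simp only [chainExponent, Finset.sum_add_distrib]
  ext (⟨i, c⟩ | ⟨c, j⟩)
  · have hv : Function.Injective2 fun (i : Fin m) (c : Fin t) =>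
        (Sum.inl (i, c) : (Fin m × Fin t) ⊕ (Fin t × Fin n)) := fun _ _ _ _ h => by simpa using h
    simp only [Finsupp.add_apply, sum_single_diagonals hv, sum_single_corners hm hv]
    simp only [Finsupp.finsetSum_apply, Finsupp.single_apply, reduceCtorEq, if_false,
      Finset.sum_const_zero, Finsupp.coe_equivFunOnFinite_symm]
    split_ifs <;> rfl
  · have hv : Function.Injective2 fun (j : Fin n) (c : Fin t) =>
        (Sum.inr (c, j) : (Fin m × Fin t) ⊕ (Fin t × Fin n)) :=
      fun _ _ _ _ h => by simpa [and_comm] using h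
    simp only [Finsupp.add_apply, sum_single_diagonals hv, sum_single_corners hn hv]
    simp only [Finsupp.finsetSum_apply, Finsupp.single_apply, reduceCtorEq, if_false,
      Finset.sum_const_zero, Finsupp.coe_equivFunOnFinite_symm]
    split_ifs <;> rfl

end SplittingPolynomialLead

section ComplexSplitting

variable {K : Type u} [Field K] (p : ℕ) [Fact p.Prime] {φ : K →+ K} {m t n : ℕ}

/-- The map `g ↦ Tr (f ^ (p - 1) * g)` on `K[Y, Z]`, where `f` is the splitting polynomial of the
generic matrices and `Tr` is the Frobenius trace over the `p`-inverse linear map `φ`. -/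
noncomputable def complexSplitting (φ : K →+ K) (hm : t ≤ m) (hn : t ≤ n) :
    PolyYZ K m t n →+ PolyYZ K m t n :=
  (frobTrace p φ).comp
    (AddMonoidHom.mulLeft (splittingPoly hm hn (matY K m t n) (matZ K m t n) ^ (p - 1)))

theorem diagWeight_nonneg (v : (Fin m × Fin t) ⊕ (Fin t × Fin n)) : 0 ≤ diagWeight m t n v :=
  Prod.Lex.toLex_mono (Prod.mk_le_mk.2 ⟨Nat.zero_le _, Nat.zero_le _⟩)

theorem isFrobeniusSplitting_complexSplitting [CharP K p] (hφ_one : φ 1 = 1)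
    (hφ : ∀ a b, φ (a ^ p * b) = a * φ b) (hm : t ≤ m) (hn : t ≤ n) :
    IsFrobeniusSplitting p (complexSplitting p φ hm hn) := by
  have hone := frobTrace_pow_eq_one p hφ_one diagWeight_nonneg (hasLead_splittingPoly K hm hn)
  constructor
  · intro a b
    simp only [complexSplitting, AddMonoidHom.comp_apply, AddMonoidHom.coe_mulLeft, frobenius_def]
    rw [mul_left_comm, frobTrace_pow_mul p φ hφ]
  · intro a
    simp only [complexSplitting, AddMonoidHom.comp_apply, AddMonoidHom.coe_mulLeft, frobenius_def]
    rw [mul_comm, frobTrace_pow_mul p φ hφ, hone, mul_one]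

end ComplexSplitting

section Chains

theorem strictMono_cons {α : Type*} [Preorder α] {a : ℕ} {x : α} {f : Fin a → α}
    (hf : StrictMono f) (hx : ∀ l, x < f l) : StrictMono (Fin.cons x f : Fin (a + 1) → α) := by
  intro l l' hl
  induction l using Fin.cases with
  | zero =>
    obtain ⟨l', rfl⟩ := Fin.exists_succ_eq.2 hl.ne'
    exact hx l'
  | succ l =>
    obtain ⟨l', rfl⟩ := Fin.exists_succ_eq.2 (Fin.ne_zero_of_lt hl)
    exact hf (Fin.succ_lt_succ_iff.1 hl)

variable {t N : ℕ}

/-- The cells satisfying `F` contain a chain of length `a`, strictly increasing in both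
coordinates, with first coordinates at least `k`. -/
def HasChain (F : Fin t → Fin N → Prop) (k a : ℕ) : Prop :=
  ∃ (c : Fin a → Fin t) (i : Fin a → Fin N), StrictMono c ∧ StrictMono i ∧
    (∀ l, F (c l) (i l)) ∧ ∀ l, k ≤ (c l : ℕ)

open Classical in
/-- The largest length of a chain of cells satisfying `F` with first coordinates at least `k`. -/
noncomputable def maxChainLength (F : Fin t → Fin N → Prop) (k : ℕ) : ℕ :=
  Nat.findGreatest (HasChain F k) t

variable {F : Fin t → Fin N → Prop} {k a : ℕ}

theorem hasChain_zero : HasChain F k 0 :=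
  ⟨Fin.elim0, Fin.elim0, fun l => l.elim0, fun l => l.elim0, fun l => l.elim0, fun l => l.elim0⟩

theorem HasChain.le (h : HasChain F k a) : a ≤ t - k := by
  obtain ⟨c, -, hc, -, -, hk⟩ := h
  have hinj : Function.Injective fun l => (⟨c l - k, by have := hk l; omega⟩ : Fin (t - k)) :=
    fun l l' hl => hc.injective <| Fin.ext <| by
      have := hk l
      have := hk l'
      have : (c l : ℕ) - k = c l' - k := Fin.ext_iff.1 hl
      omega
  simpa using Fintype.card_le_of_injective _ hinj

theorem hasChain_maxChainLength : HasChain F k (maxChainLength F k) := by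
  classical
  exact Nat.findGreatest_spec (P := HasChain F k) (Nat.zero_le t) hasChain_zero

theorem HasChain.le_maxChainLength (h : HasChain F k a) : a ≤ maxChainLength F k := by
  classical
  exact Nat.le_findGreatest (h.le.trans (Nat.sub_le _ _)) h

theorem HasChain.mono {a' : ℕ} (h : HasChain F k a) (ha : a' ≤ a) : HasChain F k a' := by
  obtain ⟨c, i, hc, hi, hF, hk⟩ := h
  exact ⟨c ∘ Fin.castLE ha, i ∘ Fin.castLE ha, hc.comp (Fin.strictMono_castLE ha),
    hi.comp (Fin.strictMono_castLE ha), fun l => hF _, fun l => hk _⟩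

theorem maxChainLength_le : maxChainLength F k ≤ t - k := hasChain_maxChainLength.le

theorem maxChainLength_succ_le : maxChainLength F (k + 1) ≤ maxChainLength F k := by
  obtain ⟨c, i, hc, hi, hF, hk⟩ := hasChain_maxChainLength (F := F) (k := k + 1)
  exact HasChain.le_maxChainLength ⟨c, i, hc, hi, hF, fun l => (Nat.le_succ k).trans (hk l)⟩

theorem maxChainLength_le_succ : maxChainLength F k ≤ maxChainLength F (k + 1) + 1 := by
  have hchain := hasChain_maxChainLength (F := F) (k := k)
  generalize maxChainLength F k = a at hchain ⊢
  rcases a with _ | b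
  · exact Nat.zero_le _
  obtain ⟨c, i, hc, hi, hF, hk⟩ := hchain
  exact Nat.succ_le_succ (HasChain.le_maxChainLength ⟨c ∘ Fin.succ, i ∘ Fin.succ,
    hc.comp Fin.strictMono_succ, hi.comp Fin.strictMono_succ, fun l => hF _,
    fun l => (hk 0).trans_lt (hc (Fin.succ_pos l))⟩)

theorem HasChain.cons {F' : Fin t → Fin N → Prop} {k' : ℕ} (h : HasChain F' k' a) {c₀ : Fin t}
    {i₀ : Fin N} (h₀ : F c₀ i₀) (hk : k ≤ (c₀ : ℕ))
    (hF' : ∀ c i, F' c i → F c i ∧ c₀ < c ∧ i₀ < i) : HasChain F k (a + 1) := by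
  obtain ⟨c, i, hc, hi, hF, -⟩ := h
  refine ⟨Fin.cons c₀ c, Fin.cons i₀ i, strictMono_cons hc fun l => (hF' _ _ (hF l)).2.1,
    strictMono_cons hi fun l => (hF' _ _ (hF l)).2.2, Fin.cases h₀ fun l => (hF' _ _ (hF l)).1,
    Fin.cases hk fun l => ?_⟩
  exact hk.trans (Fin.le_def.1 (hF' _ _ (hF l)).2.1.le)

theorem exists_chain_rank (F : Fin t → Fin N → Prop) : ∃ h : Fin t → Fin N → ℕ,
    (∀ c i, F c i → h c i < maxChainLength F c) ∧
    ∀ c i c' i', F c' i' → c < c' → i < i' → h c' i' < h c i :=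
  ⟨fun c i => maxChainLength (fun c' i' => F c' i' ∧ c < c' ∧ i < i') 0,
    fun _ _ hF => (hasChain_maxChainLength.cons hF le_rfl fun _ _ h => h).le_maxChainLength,
    fun _ _ _ _ hF hc hi => (hasChain_maxChainLength.cons ⟨hF, hc, hi⟩ (Nat.zero_le _)
      fun _ _ h => ⟨⟨h.1, hc.trans h.2.1, hi.trans h.2.2⟩, h.2⟩).le_maxChainLength⟩

/-- The number of elements of `O` that are at least `k`. -/
def countGE (O : Finset (Fin t)) (k : ℕ) : ℕ := (O.filter fun c : Fin t => k ≤ (c : ℕ)).card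

theorem countGE_of_le (O : Finset (Fin t)) (hk : t ≤ k) : countGE O k = 0 := by
  rw [countGE, Finset.card_eq_zero, Finset.filter_eq_empty_iff]
  exact fun c _ => (c.2.trans_le hk).not_ge

theorem countGE_eq (O : Finset (Fin t)) (hk : k < t) :
    countGE O k = countGE O (k + 1) + if (⟨k, hk⟩ : Fin t) ∈ O then 1 else 0 := by
  rw [countGE, countGE, Finset.card_filter, Finset.card_filter,
    ← Finset.sum_ite_eq' O ⟨k, hk⟩ fun _ => 1, ← Finset.sum_add_distrib]
  refine Finset.sum_congr rfl fun c _ => ?_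
  simp only [Fin.ext_iff]
  split_ifs <;> omega

theorem countGE_add_compl (O : Finset (Fin t)) (k : ℕ) :
    countGE O k + countGE Oᶜ k = t - k := by
  induction hd : t - k generalizing k with
  | zero => rw [countGE_of_le _ (by omega), countGE_of_le _ (by omega)]
  | succ d ih =>
    have hk : k < t := by omega
    have hsucc := ih (k + 1) (by omega)
    rw [countGE_eq O hk, countGE_eq Oᶜ hk]
    simp only [Finset.mem_compl]
    split_ifs <;> omega

theorem exists_countGE_eq_succ (O : Finset (Fin t)) {v : ℕ} (hv : v < countGE O k) :
    ∃ x ∈ O, k ≤ (x : ℕ) ∧ countGE O x = v + 1 := by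
  induction hd : t - k generalizing k with
  | zero =>
    rw [countGE_of_le O (by omega)] at hv
    omega
  | succ d ih =>
    have hk : k < t := by omega
    by_cases hsucc : v < countGE O (k + 1)
    · obtain ⟨x, hx, hkx, hval⟩ := ih hsucc (by omega)
      exact ⟨x, hx, by omega, hval⟩
    · have hstep := countGE_eq O hk
      split_ifs at hstep with hmem
      · exact ⟨⟨k, hk⟩, hmem, le_rfl, by simp only; omega⟩
      · omega

theorem exists_chain_colouring (F : Fin t → Fin N → Prop) (O : Finset (Fin t))
    (hO : ∀ k, maxChainLength F k ≤ countGE O k) : ∃ κ : Fin t → Fin N → Fin t,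
      (∀ c i, F c i → κ c i ∈ O ∧ c ≤ κ c i) ∧
      ∀ c i c' i', F c i → F c' i' → c < c' → i < i' → κ c i ≠ κ c' i' := by
  obtain ⟨h, h_lt, h_anti⟩ := exists_chain_rank F
  have hcolour c i : ∃ x : Fin t, F c i → x ∈ O ∧ c ≤ x ∧ countGE O x = h c i + 1 := by
    by_cases hF : F c i
    · obtain ⟨x, hx⟩ := exists_countGE_eq_succ O ((h_lt c i hF).trans_le (hO c))
      exact ⟨x, fun _ => hx⟩
    · exact ⟨c, fun hF' => absurd hF' hF⟩
  choose κ hκ using hcolour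
  refine ⟨κ, fun c i hF => ⟨(hκ c i hF).1, (hκ c i hF).2.1⟩, fun c i c' i' hF hF' hc hi heq => ?_⟩
  have hcount := (hκ c i hF).2.2
  rw [heq, (hκ c' i' hF').2.2] at hcount
  exact (h_anti c i c' i' hF' hc hi).ne (Nat.succ_injective hcount)

theorem exists_countGE_eq_maxChainLength (F : Fin t → Fin N → Prop) :
    ∃ D : Finset (Fin t), ∀ k, countGE D k = maxChainLength F k := by
  refine ⟨Finset.univ.filter fun c => maxChainLength F (c + 1) < maxChainLength F c, fun k => ?_⟩
  induction hd : t - k generalizing k with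
  | zero =>
    have := maxChainLength_le (F := F) (k := k)
    rw [countGE_of_le _ (by omega)]
    omega
  | succ d ih =>
    have := maxChainLength_succ_le (F := F) (k := k)
    have := maxChainLength_le_succ (F := F) (k := k)
    rw [countGE_eq _ (by omega), ih (k + 1) (by omega)]
    simp only [Finset.mem_filter_univ]
    split_ifs <;> omega

end Chains

section Potentials

variable {Γ : Type*} [AddCommGroup Γ] [LinearOrder Γ] [IsOrderedAddMonoid Γ] {t N : ℕ}

/-- The strict Monge condition on an array of weights: for two rows and two columns, the diagonal
has smaller total weight than the antidiagonal. -/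
def IsStrictMonge (w : Fin t → Fin N → Γ) : Prop :=
  ∀ ⦃c c' i i'⦄, c < c' → i < i' → w c i + w c' i' < w c i' + w c' i

theorem IsStrictMonge.antitone_sub {w : Fin t → Fin N → Γ} (hw : IsStrictMonge w) {i i' : Fin N}
    (hi : i < i') : Antitone fun c => w c i' - w c i := by
  refine antitone_iff_forall_lt.2 fun c c' hc => ?_
  rw [sub_le_sub_iff, add_comm]
  exact (hw hc hi).le

theorem sub_sum_range_le_of_antitone {ι : Type*} [Preorder ι] {W : ι → ℕ → Γ}
    (hW : ∀ k, k + 1 < N → Antitone fun c => W c (k + 1) - W c k) {f : ℕ → ι} {c : ι} {i i' : ℕ}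
    (hi : i < N) (hi' : i' < N) (hle : ∀ k, i ≤ k → f k ≤ c) (hge : ∀ k < i, c ≤ f k) :
    W c i' - ∑ k ∈ Finset.range i', (W (f k) (k + 1) - W (f k) k) ≤
      W c i - ∑ k ∈ Finset.range i, (W (f k) (k + 1) - W (f k) k) := by
  set g : ℕ → Γ := fun j => W c j - ∑ k ∈ Finset.range j, (W (f k) (k + 1) - W (f k) k) with hg
  have hstep k : g (k + 1) - g k = (W c (k + 1) - W c k) - (W (f k) (k + 1) - W (f k) k) := by
    simp only [hg, Finset.sum_range_succ]
    abel
  rcases le_total i i' with hii' | hii'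
  · refine antitoneOn_of_succ_le (f := g) (Set.ordConnected_Ico (a := i) (b := N))
      (fun k _ hk hk' => ?_) ⟨le_rfl, hi⟩ ⟨hii', hi'⟩ hii'
    rw [Nat.succ_eq_succ, ← sub_nonpos, hstep, sub_nonpos]
    exact hW k hk'.2 (hle k hk.1)
  · refine monotoneOn_of_le_succ (f := g) (Set.ordConnected_Iic (a := i))
      (fun k _ _ hk' => ?_) hii' (Set.self_mem_Iic) hii'
    have hk : k < i := hk'
    rw [Nat.succ_eq_succ, ← sub_nonneg, hstep, sub_nonneg]
    exact hW k (by omega) (hge k hk)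

theorem IsStrictMonge.exists_potentials {w : Fin t → Fin N → Γ} (hw : IsStrictMonge w)
    (hN : 0 < N) (P : Fin t → Fin N → Prop)
    (hP : ∀ c c' i i', c < c' → i < i' → P c i → P c' i' → False) :
    ∃ (α : Fin N → Γ) (β : Fin t → Γ), (∀ c i, w c i ≤ α i + β c) ∧
      (∀ c, ∃ i, w c i = α i + β c) ∧ ∀ c i, P c i → w c i = α i + β c := by
  rcases t.eq_zero_or_pos with rfl | ht
  · exact ⟨0, 0, fun c => c.elim0, fun c => c.elim0, fun c => c.elim0⟩
  have : NeZero t := ⟨ht.ne'⟩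
  have : NeZero N := ⟨hN.ne'⟩
  let f (k : ℕ) : Fin t := sInf {c | ∃ i : Fin N, (i : ℕ) ≤ k ∧ P c i}
  let W (c : Fin t) (k : ℕ) : Γ := w c (Fin.ofNat N k)
  have hW c (i : Fin N) : W c i = w c i := by simp only [W, Fin.ofNat_val_eq_self]
  have hanti k (hk : k + 1 < N) : Antitone fun c => W c (k + 1) - W c k := by
    have hWk c : W c k = w c ⟨k, by omega⟩ := hW c ⟨k, by omega⟩
    have hWk_succ c : W c (k + 1) = w c ⟨k + 1, hk⟩ := hW c ⟨k + 1, hk⟩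
    simp only [hWk, hWk_succ]
    exact hw.antitone_sub (Fin.mk_lt_mk.2 k.lt_succ_self)
  let α (i : Fin N) : Γ := ∑ k ∈ Finset.range i, (W (f k) (k + 1) - W (f k) k)
  have hbest c i (h : P c i) i' : w c i' - α i' ≤ w c i - α i := by
    simp only [← hW]
    refine sub_sum_range_le_of_antitone hanti i.2 i'.2 (fun k hk => sInf_le ⟨i, hk, h⟩)
      fun k hk => le_sInf ?_
    rintro c' ⟨i', hi', h'⟩
    exact not_lt.1 fun hlt => hP c' c i' i hlt (Fin.lt_def.2 (hi'.trans_lt hk)) h' h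
  refine ⟨α, fun c => Finset.univ.sup' Finset.univ_nonempty fun i => w c i - α i, ?_, ?_, ?_⟩
  · intro c i
    rw [← sub_le_iff_le_add']
    exact Finset.le_sup' (fun i => w c i - α i) (Finset.mem_univ i)
  · intro c
    obtain ⟨i, -, hi⟩ := Finset.exists_mem_eq_sup' Finset.univ_nonempty fun i => w c i - α i
    exact ⟨i, by simp only [hi, add_sub_cancel]⟩
  · intro c i h
    rw [← sub_eq_iff_eq_add']
    exact le_antisymm (Finset.le_sup' (fun i => w c i - α i) (Finset.mem_univ i))
      (Finset.sup'_le _ _ fun i' _ => hbest c i h i')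

theorem IsStrictMonge.exists_potentials_of_colouring {ι : Type*} {w : Fin t → Fin N → Γ}
    (hw : IsStrictMonge w) (hN : 0 < N) (F : Fin t → Fin N → Prop) (col : Fin t → Fin N → ι)
    (hcol : ∀ c i c' i', F c i → F c' i' → c < c' → i < i' → col c i ≠ col c' i') :
    ∃ (α : ι → Fin N → Γ) (β : ι → Fin t → Γ), (∀ κ c i, w c i ≤ α κ i + β κ c) ∧
      (∀ κ c, ∃ i, w c i = α κ i + β κ c) ∧
      ∀ c i, F c i → w c i = α (col c i) i + β (col c i) c := by
  choose α β hle htight hcell using fun κ =>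
    hw.exists_potentials hN (fun c i => F c i ∧ col c i = κ) fun c c' i i' hc hi h h' =>
      hcol c i c' i' h.1 h'.1 hc hi (h.2.trans h'.2.symm)
  exact ⟨α, β, hle, htight, fun c i h => hcell _ c i ⟨h, rfl⟩⟩

end Potentials

section ValuedPoints

open HahnSeries

variable {Γ : Type w} [AddCommGroup Γ] [LinearOrder Γ] [IsOrderedAddMonoid Γ] {A : Type u} [Field A]

theorem addVal_single_one (γ : Γ) : addVal Γ A (single γ (1 : A)) = γ := by
  rw [addVal_apply, orderTop_single one_ne_zero]

theorem le_addVal_sum_C_mul {ι : Type*} {O : Finset ι} (x : ι → A) {z : ι → HahnSeries Γ A}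
    {g : WithTop Γ} (hz : ∀ κ ∈ O, g ≤ addVal Γ A (z κ)) :
    g ≤ addVal Γ A (∑ κ ∈ O, C (x κ) * z κ) := by
  refine AddValuation.map_le_sum _ fun κ hκ => ?_
  rw [C_mul_eq_smul]
  by_cases hx : x κ = 0
  · rw [hx, zero_smul, AddValuation.map_zero]
    exact le_top
  · rw [← C_mul_eq_smul, AddValuation.map_mul, C_apply, addVal_apply, orderTop_single hx,
      WithTop.coe_zero, zero_add]
    exact hz κ hκ

theorem addVal_sum_C_mul_eq {ι : Type*} {O : Finset ι} {x : ι → A}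
    (hx : ∀ s : Finset ι, s.Nonempty → ∑ κ ∈ s, x κ ≠ 0) {z : ι → HahnSeries Γ A} {g : Γ}
    (hz : ∀ κ ∈ O, z κ = single g 1 ∨ g < addVal Γ A (z κ)) (hg : ∃ κ ∈ O, z κ = single g 1) :
    addVal Γ A (∑ κ ∈ O, C (x κ) * z κ) = g := by
  classical
  obtain ⟨κ₀, hκ₀, h₀⟩ := hg
  have hle κ (hκ : κ ∈ O) : (g : WithTop Γ) ≤ addVal Γ A (z κ) :=
    (hz κ hκ).elim (fun h => by rw [h, addVal_single_one]) le_of_lt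
  refine le_antisymm (addVal_le_of_coeff_ne_zero ?_) (le_addVal_sum_C_mul x hle)
  have hcoeff : (∑ κ ∈ O, C (x κ) * z κ).coeff g = ∑ κ ∈ O.filter (z · = single g 1), x κ := by
    rw [coeff_sum, Finset.sum_filter]
    refine Finset.sum_congr rfl fun κ hκ => ?_
    rw [C_mul_eq_smul, coeff_smul, smul_eq_mul]
    split_ifs with h
    · rw [h, coeff_single_same, mul_one]
    · have hlt := (hz κ hκ).resolve_left h
      rw [addVal_apply] at hlt
      rw [coeff_eq_zero_of_lt_orderTop hlt, mul_zero]
  rw [hcoeff]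
  exact hx _ ⟨κ₀, Finset.mem_filter.2 ⟨hκ₀, h₀⟩⟩

variable {t : ℕ}

/-- A vector with entries of valuation `β` up to position `κ`, with zero entries at the later
positions in `O`, and whose entries at the later positions outside `O` make it orthogonal to every
vector with entries of valuation `π c` up to position `c` and zero entries outside `O` from there
on. -/
noncomputable def kernelVec (A : Type u) [Field A] (O : Finset (Fin t)) (β : Fin t → Γ)
    (π : Fin t → Fin t → Γ) (κ : Fin t) (c : Fin t) : HahnSeries Γ A :=
  if c ≤ κ then single (β c) 1
  else if c ∈ O then 0
  else -∑ c' : {c' // c' < c}, kernelVec A O β π κ c'.1 * single (π c c'.1 - π c c) 1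
termination_by c.val
decreasing_by exact c'.2

section KernelVec

variable (O : Finset (Fin t)) (β : Fin t → Γ) (π : Fin t → Fin t → Γ) (κ : Fin t) {c : Fin t}

theorem kernelVec_of_le (h : c ≤ κ) : kernelVec A O β π κ c = single (β c) 1 := by
  rw [kernelVec, if_pos h]

theorem kernelVec_of_mem (h : κ < c) (hc : c ∈ O) : kernelVec A O β π κ c = 0 := by
  rw [kernelVec, if_neg h.not_ge, if_pos hc]

theorem kernelVec_mul_single (h : κ < c) (hc : c ∉ O) :
    kernelVec A O β π κ c * single (π c c) 1 =
      -∑ c' ∈ Finset.Iio c, kernelVec A O β π κ c' * single (π c c') 1 := by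
  have hIio : ∑ c' ∈ Finset.Iio c, kernelVec A O β π κ c' * single (π c c') 1 =
      ∑ c' : {c' // c' < c}, kernelVec A O β π κ c'.1 * single (π c c'.1) 1 :=
    Finset.sum_subtype _ (fun _ => Finset.mem_Iio) _
  rw [hIio, kernelVec, if_neg h.not_ge, if_neg hc, neg_mul, Finset.sum_mul]
  simp only [mul_assoc, single_mul_single, mul_one, sub_add_cancel]

variable {O β π}

theorem le_addVal_kernelVec_and_lt (hπ : ∀ c ∉ O, ∀ c' < c, β c + π c c < β c' + π c c')
    (c : Fin t) : β c ≤ addVal Γ A (kernelVec A O β π κ c) ∧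
      (κ < c → β c < addVal Γ A (kernelVec A O β π κ c)) := by
  induction c using WellFoundedLT.induction with
  | ind c ih =>
    rcases le_or_gt c κ with h | h
    · rw [kernelVec_of_le O β π κ h, addVal_single_one]
      exact ⟨le_rfl, fun h' => absurd h h'.not_ge⟩
    · suffices hs : β c < addVal Γ A (kernelVec A O β π κ c) from ⟨hs.le, fun _ => hs⟩
      by_cases hc : c ∈ O
      · rw [kernelVec_of_mem O β π κ h hc, AddValuation.map_zero]
        exact WithTop.coe_lt_top _
      · rw [kernelVec, if_neg h.not_ge, if_neg hc, AddValuation.map_neg]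
        refine AddValuation.map_lt_sum _ WithTop.coe_ne_top fun c' _ => ?_
        rw [AddValuation.map_mul, addVal_single_one]
        refine lt_of_lt_of_le ?_ (add_le_add_left (ih c'.1 c'.2).1 _)
        rw [← WithTop.coe_add, WithTop.coe_lt_coe, ← add_sub_assoc, lt_sub_iff_add_lt]
        exact hπ c hc c'.1 c'.2

theorem sum_kernelVec_mul_kernelVec_of_lt {β π : Fin t → Fin t → Γ} {κ ζ : Fin t} (hζ : ζ ∉ O)
    (hlt : κ < ζ) : ∑ c, kernelVec A O (β κ) π κ c * kernelVec A Oᶜ (π ζ) β ζ c = 0 := by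
  have htail c (hc : c ∉ Finset.Iic ζ) :
      kernelVec A O (β κ) π κ c * kernelVec A Oᶜ (π ζ) β ζ c = 0 := by
    have hζc : ζ < c := not_le.1 fun h => hc (Finset.mem_Iic.2 h)
    by_cases hcO : c ∈ O
    · rw [kernelVec_of_mem O _ _ _ (hlt.trans hζc) hcO, zero_mul]
    · rw [kernelVec_of_mem Oᶜ _ _ _ hζc (Finset.mem_compl.2 hcO), mul_zero]
  rw [← Finset.sum_subset (Finset.subset_univ (Finset.Iic ζ)) fun c _ => htail c,
    ← Finset.Iio_insert, Finset.sum_insert Finset.notMem_Iio_self,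
    kernelVec_of_le Oᶜ (π ζ) β ζ le_rfl, kernelVec_mul_single O _ _ _ hlt hζ, neg_add_eq_zero]
  refine Finset.sum_congr rfl fun c hc => ?_
  rw [kernelVec_of_le Oᶜ (π ζ) β ζ (Finset.mem_Iio.1 hc).le]

theorem sum_kernelVec_mul_kernelVec {β π : Fin t → Fin t → Γ} {κ ζ : Fin t} (hκ : κ ∈ O)
    (hζ : ζ ∉ O) : ∑ c, kernelVec A O (β κ) π κ c * kernelVec A Oᶜ (π ζ) β ζ c = 0 := by
  rcases lt_trichotomy κ ζ with h | rfl | h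
  · exact sum_kernelVec_mul_kernelVec_of_lt hζ h
  · exact absurd hκ hζ
  · have hswap := sum_kernelVec_mul_kernelVec_of_lt (A := A) (β := π) (π := β)
      (O := Oᶜ) (Finset.mem_compl.not.2 (not_not.2 hκ)) h
    rw [compl_compl] at hswap
    simpa only [mul_comm] using hswap

end KernelVec

section KernelMatrix

variable {N : ℕ}

/-- The matrix whose columns are linear combinations of the vectors `kernelVec` attached to the
positions in `O`, with coefficients of leading coefficient `x` and valuation `α`. -/
noncomputable def kernelMatrix (O : Finset (Fin t)) (x : Fin t → A) (α : Fin t → Fin N → Γ)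
    (β π : Fin t → Fin t → Γ) : Matrix (Fin t) (Fin N) (HahnSeries Γ A) :=
  Matrix.of fun c i => ∑ κ ∈ O, C (x κ) * (single (α κ i) 1 * kernelVec A O (β κ) π κ c)

theorem transpose_kernelMatrix_mul_kernelMatrix {N' : ℕ} (O : Finset (Fin t)) (x : Fin t → A)
    (α : Fin t → Fin N → Γ) (ω : Fin t → Fin N' → Γ) (β π : Fin t → Fin t → Γ) :
    (kernelMatrix O x α β π).transpose * kernelMatrix Oᶜ x ω π β = 0 := by
  ext1 i j
  simp only [Matrix.mul_apply, Matrix.transpose_apply, kernelMatrix, Matrix.of_apply,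
    Matrix.zero_apply, Finset.sum_mul_sum]
  rw [Finset.sum_comm]
  refine Finset.sum_eq_zero fun κ hκ => ?_
  rw [Finset.sum_comm]
  refine Finset.sum_eq_zero fun ζ hζ => ?_
  calc ∑ c, C (x κ) * (single (α κ i) 1 * kernelVec A O (β κ) π κ c) *
        (C (x ζ) * (single (ω ζ j) 1 * kernelVec A Oᶜ (π ζ) β ζ c))
      = C (x κ) * single (α κ i) 1 * (C (x ζ) * single (ω ζ j) 1) *
          ∑ c, kernelVec A O (β κ) π κ c * kernelVec A Oᶜ (π ζ) β ζ c := by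
        rw [Finset.mul_sum]
        exact Finset.sum_congr rfl fun c _ => by ring
    _ = 0 := by rw [sum_kernelVec_mul_kernelVec hκ (Finset.mem_compl.1 hζ), mul_zero]

theorem addVal_kernelMatrix {O : Finset (Fin t)} {x : Fin t → A}
    (hx : ∀ s : Finset (Fin t), s.Nonempty → ∑ κ ∈ s, x κ ≠ 0) {w : Fin t → Fin N → Γ}
    {F : Fin t → Fin N → Prop} {col : Fin t → Fin N → Fin t}
    (hcol : ∀ c i, F c i → col c i ∈ O ∧ c ≤ col c i)
    {α : Fin t → Fin N → Γ} {β π : Fin t → Fin t → Γ} (hle : ∀ κ c i, w c i ≤ α κ i + β κ c)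
    (htight : ∀ c i, F c i → w c i = α (col c i) i + β (col c i) c)
    (hπ : ∀ κ, ∀ c ∉ O, ∀ c' < c, β κ c + π c c < β κ c' + π c c') (c : Fin t) (i : Fin N) :
    w c i ≤ addVal Γ A (kernelMatrix O x α β π c i) ∧
      (F c i → addVal Γ A (kernelMatrix O x α β π c i) = w c i) := by
  have hterm κ : single (α κ i) 1 * kernelVec A O (β κ) π κ c = single (w c i) 1 ∨
      w c i < addVal Γ A (single (α κ i) 1 * kernelVec A O (β κ) π κ c) := by
    rcases le_or_gt c κ with h | h
    · rw [kernelVec_of_le O _ _ _ h, single_mul_single, mul_one, addVal_single_one,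
        WithTop.coe_lt_coe]
      exact (hle κ c i).eq_or_lt.imp_left fun h => by rw [h]
    · rw [AddValuation.map_mul, addVal_single_one]
      refine Or.inr ((WithTop.coe_le_coe.2 (hle κ c i)).trans_lt ?_)
      rw [WithTop.coe_add]
      exact WithTop.add_lt_add_left WithTop.coe_ne_top ((le_addVal_kernelVec_and_lt κ (hπ κ) c).2 h)
  refine ⟨le_addVal_sum_C_mul x fun κ _ => ?_, fun hF => addVal_sum_C_mul_eq hx
    (fun κ _ => hterm κ) ⟨col c i, (hcol c i hF).1, ?_⟩⟩
  · exact (hterm κ).elim (fun h => by rw [h, addVal_single_one]) le_of_lt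
  · rw [kernelVec_of_le O _ _ _ (hcol c i hF).2, single_mul_single, mul_one, htight c i hF]

end KernelMatrix

variable {m n : ℕ}

theorem exists_complementary_colourings {FY : Fin t → Fin m → Prop} {FZ : Fin t → Fin n → Prop}
    (hF : ∀ k ≤ t, maxChainLength FY k + maxChainLength FZ k ≤ t - k) :
    ∃ (O : Finset (Fin t)) (colY : Fin t → Fin m → Fin t) (colZ : Fin t → Fin n → Fin t),
      ((∀ c i, FY c i → colY c i ∈ O ∧ c ≤ colY c i) ∧
        ∀ c i c' i', FY c i → FY c' i' → c < c' → i < i' → colY c i ≠ colY c' i') ∧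
      (∀ c j, FZ c j → colZ c j ∈ Oᶜ ∧ c ≤ colZ c j) ∧
        ∀ c j c' j', FZ c j → FZ c' j' → c < c' → j < j' → colZ c j ≠ colZ c' j' := by
  obtain ⟨O, hO⟩ := exists_countGE_eq_maxChainLength FY
  obtain ⟨colY, hcolY⟩ := exists_chain_colouring FY O fun k => (hO k).ge
  obtain ⟨colZ, hcolZ⟩ := exists_chain_colouring FZ Oᶜ fun k => by
    have := countGE_add_compl O k
    rw [hO] at this
    rcases le_or_gt k t with hk | hk
    · have := hF k hk
      omega
    · have := maxChainLength_le (F := FZ) (k := k)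
      omega
  exact ⟨O, colY, colZ, hcolY, hcolZ⟩

theorem exists_mul_eq_zero_of_maxChainLength_add_le {x : Fin t → A}
    (hx : ∀ s : Finset (Fin t), s.Nonempty → ∑ κ ∈ s, x κ ≠ 0) (hm : 0 < m) (hn : 0 < n)
    {wY : Fin t → Fin m → Γ} {wZ : Fin t → Fin n → Γ} (hY : IsStrictMonge wY)
    (hZ : IsStrictMonge wZ)
    (hYZ : ∀ c c' i j, c < c' → wY c' i + wZ c' j < wY c i + wZ c j)
    {FY : Fin t → Fin m → Prop} {FZ : Fin t → Fin n → Prop}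
    (hF : ∀ k ≤ t, maxChainLength FY k + maxChainLength FZ k ≤ t - k) :
    ∃ (Y : Matrix (Fin m) (Fin t) (HahnSeries Γ A)) (Z : Matrix (Fin t) (Fin n) (HahnSeries Γ A)),
      Y * Z = 0 ∧
      (∀ c i, wY c i ≤ addVal Γ A (Y i c) ∧ (FY c i → addVal Γ A (Y i c) = wY c i)) ∧
      ∀ c j, wZ c j ≤ addVal Γ A (Z c j) ∧ (FZ c j → addVal Γ A (Z c j) = wZ c j) := by
  obtain ⟨O, colY, colZ, ⟨hcolY, hantiY⟩, hcolZ, hantiZ⟩ := exists_complementary_colourings hF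
  obtain ⟨α, β, hleY, htightY, hcellY⟩ := hY.exists_potentials_of_colouring hm FY colY hantiY
  obtain ⟨ω, π, hleZ, htightZ, hcellZ⟩ := hZ.exists_potentials_of_colouring hn FZ colZ hantiZ
  have hdrop κ ζ c c' (hc : c' < c) : β κ c + π ζ c < β κ c' + π ζ c' := by
    obtain ⟨i, hi⟩ := htightY κ c
    obtain ⟨j, hj⟩ := htightZ ζ c
    have hlt := (hYZ c' c i j hc).trans_le (add_le_add (hleY κ c' i) (hleZ ζ c' j))
    rw [hi, hj, add_add_add_comm, add_add_add_comm (α κ i) (β κ c')] at hlt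
    exact lt_of_add_lt_add_left hlt
  refine ⟨(kernelMatrix O x α β π).transpose, kernelMatrix Oᶜ x ω π β,
    transpose_kernelMatrix_mul_kernelMatrix O x α ω β π, ?_, ?_⟩
  · exact addVal_kernelMatrix hx hcolY hleY hcellY fun κ c _ c' hc => hdrop κ c c c' hc
  · refine addVal_kernelMatrix hx hcolZ hleZ hcellZ fun ζ c _ c' hc => ?_
    rw [add_comm, add_comm (π ζ c')]
    exact hdrop c ζ c c' hc

theorem exists_mul_of_maxChainLength_le {r : ℕ} {x : Fin r → A}
    (hx : ∀ s : Finset (Fin r), s.Nonempty → ∑ κ ∈ s, x κ ≠ 0) (hm : 0 < m)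
    {w : Fin t → Fin m → Γ} (hw : IsStrictMonge w) {F : Fin t → Fin m → Prop}
    (hF : maxChainLength F 0 ≤ r) :
    ∃ (U : Matrix (Fin m) (Fin r) (HahnSeries Γ A)) (V : Matrix (Fin r) (Fin t) (HahnSeries Γ A)),
      ∀ c i, w c i ≤ addVal Γ A ((U * V) i c) ∧ (F c i → addVal Γ A ((U * V) i c) = w c i) := by
  obtain ⟨h, h_lt, h_anti⟩ := exists_chain_rank F
  have h_lt_r c i (hc : F c i) : h c i < r := by
    obtain ⟨c', i', hc', hi', hF', -⟩ := hasChain_maxChainLength (F := F) (k := c)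
    exact ((h_lt c i hc).trans_le (HasChain.le_maxChainLength
      ⟨c', i', hc', hi', hF', fun _ => Nat.zero_le _⟩)).trans_le hF
  obtain ⟨α, β, hle, -, hcell⟩ := hw.exists_potentials_of_colouring hm F h
    fun c i c' i' _ hF' hc hi => (h_anti c i c' i' hF' hc hi).ne'
  refine ⟨Matrix.of fun i κ => C (x κ) * single (α κ i) 1,
    Matrix.of fun κ c => single (β κ c) 1, fun c i => ?_⟩
  simp only [Matrix.mul_apply, Matrix.of_apply, mul_assoc, single_mul_single, mul_one]
  refine ⟨le_addVal_sum_C_mul x fun κ _ => ?_, fun hc => addVal_sum_C_mul_eq hx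
    (fun κ _ => ?_) ⟨⟨h c i, h_lt_r c i hc⟩, Finset.mem_univ _, by rw [hcell c i hc]⟩⟩
  · rw [addVal_single_one]
    exact WithTop.coe_le_coe.2 (hle κ c i)
  · rw [addVal_single_one, WithTop.coe_lt_coe]
    exact (hle κ c i).eq_or_lt.imp_left fun h => by rw [h]

end ValuedPoints

section Nonvanishing

open HahnSeries

theorem coe_linearCombination_eq_sum {Γ : Type w} [AddCommMonoid Γ] {σ : Type*} (w : σ → Γ)
    (e : σ →₀ ℕ) : ((Finsupp.linearCombination ℕ w e : Γ) : WithTop Γ) =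
      ∑ v ∈ e.support, e v • (w v : WithTop Γ) := by
  rw [Finsupp.linearCombination_apply, Finsupp.sum, WithTop.coe_sum]
  rfl

variable {Γ : Type w} [AddCommGroup Γ] [LinearOrder Γ] [IsOrderedAddMonoid Γ] {A : Type u} [Field A]
  {K : Type v} [Field K] [Algebra K A] {σ : Type*}

theorem addVal_algebraMap {a : K} (ha : a ≠ 0) :
    addVal Γ A (algebraMap K (HahnSeries Γ A) a) = 0 := by
  rw [HahnSeries.algebraMap_apply, C_apply, addVal_apply,
    orderTop_single ((map_ne_zero_iff _ (algebraMap K A).injective).2 ha), WithTop.coe_zero]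

theorem addVal_prod_pow (x : σ → HahnSeries Γ A) (e : σ →₀ ℕ) :
    addVal Γ A (∏ v ∈ e.support, x v ^ e v) = ∑ v ∈ e.support, e v • addVal Γ A (x v) := by
  classical
  induction e.support using Finset.induction_on with
  | empty => rw [Finset.prod_empty, Finset.sum_empty, AddValuation.map_one]
  | insert v s hv ih =>
    rw [Finset.prod_insert hv, Finset.sum_insert hv, AddValuation.map_mul, AddValuation.map_pow, ih]

theorem exists_support_forall_aeval_ne_zero {w : σ → Γ} (hw : LinearIndependent ℕ w)
    {g : MvPolynomial σ K} (hg : g ≠ 0) :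
    ∃ e ∈ g.support, ∀ x : σ → HahnSeries Γ A,
      (∀ v, w v ≤ addVal Γ A (x v) ∧ (e v ≠ 0 → addVal Γ A (x v) = w v)) →
      MvPolynomial.aeval x g ≠ 0 := by
  classical
  obtain ⟨e, he, hmin⟩ := g.support.exists_min_image (Finsupp.linearCombination ℕ w)
    (MvPolynomial.support_nonempty.2 hg)
  refine ⟨e, he, fun x hx hzero => ?_⟩
  have hterm d (hd : d ∈ g.support) : addVal Γ A (algebraMap K (HahnSeries Γ A) (g.coeff d) *
      ∏ v ∈ d.support, x v ^ d v) = ∑ v ∈ d.support, d v • addVal Γ A (x v) := by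
    rw [AddValuation.map_mul, addVal_algebraMap (MvPolynomial.mem_support_iff.1 hd), zero_add,
      addVal_prod_pow]
  have hlead : addVal Γ A (algebraMap K (HahnSeries Γ A) (g.coeff e) *
      ∏ v ∈ e.support, x v ^ e v) = (Finsupp.linearCombination ℕ w e : Γ) := by
    rw [hterm e he, coe_linearCombination_eq_sum]
    exact Finset.sum_congr rfl fun v hv => by rw [(hx v).2 (Finsupp.mem_support_iff.1 hv)]
  have htail : ((Finsupp.linearCombination ℕ w e : Γ) : WithTop Γ) <
      addVal Γ A (∑ d ∈ g.support.erase e,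
        algebraMap K (HahnSeries Γ A) (g.coeff d) * ∏ v ∈ d.support, x v ^ d v) := by
    refine AddValuation.map_lt_sum _ WithTop.coe_ne_top fun d hd => ?_
    obtain ⟨hne, hd⟩ := Finset.mem_erase.1 hd
    refine (WithTop.coe_lt_coe.2 ((hmin d hd).lt_of_ne fun h => hne (hw h).symm)).trans_le ?_
    rw [hterm d hd, coe_linearCombination_eq_sum]
    exact Finset.sum_le_sum fun v _ => nsmul_le_nsmul_right (hx v).1 _
  rw [MvPolynomial.aeval_def, MvPolynomial.eval₂_eq, ← Finset.add_sum_erase _ _ he] at hzero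
  rw [eq_neg_of_add_eq_zero_left hzero, AddValuation.map_neg] at hlead
  exact htail.ne' hlead

end Nonvanishing

section GenericWeights

variable (K : Type u) [Field K]

/-- The coefficient field of the valued points. It is larger than `K` so that it contains families
of any length without vanishing subsums, also when `K` is finite. -/
abbrev CoeffField : Type u := FractionRing (Polynomial K)

theorem sum_X_pow_ne_zero {r : ℕ} (s : Finset (Fin r)) (hs : s.Nonempty) :
    ∑ κ ∈ s, algebraMap (Polynomial K) (CoeffField K) (Polynomial.X ^ (κ : ℕ)) ≠ 0 := by
  obtain ⟨κ, hκ⟩ := hs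
  rw [← map_sum, Ne, FaithfulSMul.algebraMap_eq_zero_iff]
  intro h
  have := congrArg (Polynomial.coeff · (κ : ℕ)) h
  simp [Polynomial.finsetSum_coeff, Polynomial.coeff_X_pow, ← Fin.ext_iff, hκ] at this

variable (m t n : ℕ)

/-- The value group of the valued points: the first two coordinates record the negative of
`diagWeight`, and the others, one for each variable, make the valuations of the variables linearly
independent. -/
abbrev ValueGroup : Type :=
  ℤ ×ₗ ℤ ×ₗ Lex (Fin (Fintype.card ((Fin m × Fin t) ⊕ (Fin t × Fin n))) → ℤ)

/-- The prescribed valuation of a variable. It refines the negative of `diagWeight`, since the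
lowest term with respect to a valuation plays the role of the leading term. -/
noncomputable def genericWeight (v : (Fin m × Fin t) ⊕ (Fin t × Fin n)) : ValueGroup m t n :=
  toLex (-((ofLex (diagWeight m t n v)).1 : ℤ),
    toLex (-((ofLex (diagWeight m t n v)).2 : ℤ), toLex (Pi.single (Fintype.equivFin _ v) 1)))

theorem linearIndependent_genericWeight : LinearIndependent ℕ (genericWeight m t n) := by
  classical
  let coord v : ValueGroup m t n →+ ℤ :=
    { toFun := fun γ => ofLex (ofLex (ofLex γ).2).2 (Fintype.equivFin _ v)
      map_zero' := rfl
      map_add' := fun _ _ => rfl }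
  have hcoord v u : coord v (genericWeight m t n u) = if v = u then 1 else 0 := by
    change (Pi.single (Fintype.equivFin _ u) 1 : _ → ℤ) (Fintype.equivFin _ v) = _
    simp only [Pi.single_apply, EmbeddingLike.apply_eq_iff_eq]
  have hsum e v : coord v (Finsupp.linearCombination ℕ (genericWeight m t n) e) = e v := by
    rw [Finsupp.linearCombination_apply, map_finsuppSum]
    simp only [map_nsmul, hcoord]
    simp only [nsmul_eq_mul, mul_ite, mul_one, mul_zero]
    rw [Finsupp.sum_ite_eq, ite_eq_left_iff]
    exact fun hv => by rw [Finsupp.notMem_support_iff.1 hv, Nat.cast_zero]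
  intro e e' h
  ext v
  exact_mod_cast (hsum e v).symm.trans ((congrArg (coord v) h).trans (hsum e' v))

theorem isStrictMonge_genericWeight_inl :
    IsStrictMonge fun (c : Fin t) (i : Fin m) => genericWeight m t n (Sum.inl (i, c)) := by
  intro c c' i i' hc hi
  refine Prod.Lex.lt_iff.2 (Or.inr ⟨?_, Prod.Lex.lt_iff.2 (Or.inl ?_)⟩)
  · exact rfl
  · change -((i * c : ℕ) : ℤ) + -((i' * c' : ℕ) : ℤ) < -((i' * c : ℕ) : ℤ) + -((i * c' : ℕ) : ℤ)
    have hc' : (c : ℤ) < c' := by exact_mod_cast hc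
    have hi' : (i : ℤ) < i' := by exact_mod_cast hi
    push_cast
    nlinarith

theorem isStrictMonge_genericWeight_inr :
    IsStrictMonge fun (c : Fin t) (j : Fin n) => genericWeight m t n (Sum.inr (c, j)) := by
  intro c c' j j' hc hj
  refine Prod.Lex.lt_iff.2 (Or.inr ⟨?_, Prod.Lex.lt_iff.2 (Or.inl ?_)⟩)
  · exact rfl
  · change -((c * j : ℕ) : ℤ) + -((c' * j' : ℕ) : ℤ) < -((c * j' : ℕ) : ℤ) + -((c' * j : ℕ) : ℤ)
    have hc' : (c : ℤ) < c' := by exact_mod_cast hc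
    have hj' : (j : ℤ) < j' := by exact_mod_cast hj
    push_cast
    nlinarith

theorem genericWeight_add_lt {c c' : Fin t} (i : Fin m) (j : Fin n) (hc : c < c') :
    genericWeight m t n (Sum.inl (i, c')) + genericWeight m t n (Sum.inr (c', j)) <
      genericWeight m t n (Sum.inl (i, c)) + genericWeight m t n (Sum.inr (c, j)) := by
  refine Prod.Lex.lt_iff.2 (Or.inl ?_)
  change -((2 * c' : ℕ) : ℤ) + -((2 * c' : ℕ) : ℤ) < -((2 * c : ℕ) : ℤ) + -((2 * c : ℕ) : ℤ)
  have := Fin.lt_def.1 hc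
  omega

end GenericWeights

section MaximalMinors

variable {m t n : ℕ}

theorem injective_of_det_submatrix_ne_zero {R : Type u} [CommRing R] {μ τ κ : Type*} [Fintype κ]
    [DecidableEq κ] {Y : Matrix μ τ R} {f : κ → μ} {g : κ → τ} (h : (Y.submatrix f g).det ≠ 0) :
    Function.Injective f ∧ Function.Injective g := by
  refine ⟨fun a b hab => ?_, fun a b hab => ?_⟩ <;> by_contra hne
  · exact h (Matrix.det_zero_of_row_eq hne (congrArg (fun i c => Y i (g c)) hab))
  · exact h (Matrix.det_zero_of_column_eq hne fun i => congrArg (Y (f i)) hab)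

theorem exists_minor_ne_zero_and_schurDefect_eq_zero {L : Type u} [Field L]
    (Y : Matrix (Fin m) (Fin t) L) :
    ∃ (r : ℕ) (R : Fin r ↪ Fin m) (C : Fin r ↪ Fin t), (Y.submatrix R C).det ≠ 0 ∧
      schurDefect Y R C = 0 := by
  classical
  let P r := ∃ (R : Fin r → Fin m) (C : Fin r → Fin t), (Y.submatrix R C).det ≠ 0
  have hP_zero : P 0 := ⟨Fin.elim0, Fin.elim0, Matrix.det_isEmpty.trans_ne one_ne_zero⟩
  have hP_le r : P r → r ≤ m := fun ⟨R, C, h⟩ => by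
    simpa only [Fintype.card_fin] using
      Fintype.card_le_of_injective R (injective_of_det_submatrix_ne_zero h).1
  obtain ⟨R, C, h⟩ := Nat.findGreatest_spec (P := P) (Nat.zero_le m) hP_zero
  have hinj := injective_of_det_submatrix_ne_zero h
  refine ⟨_, ⟨R, hinj.1⟩, ⟨C, hinj.2⟩, h,
    schurDefect_eq_zero_of_det_eq_zero (isUnit_iff_ne_zero.2 h) fun i c => ?_⟩
  by_contra hne
  have hP_succ : P (Nat.findGreatest P m + 1) := by
    let E := finSuccEquivLast.trans (Equiv.optionEquivSumPUnit (Fin (Nat.findGreatest P m)))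
    refine ⟨Sum.elim R (fun _ => i) ∘ E, Sum.elim C (fun _ => c) ∘ E, ?_⟩
    rwa [← Matrix.submatrix_submatrix, Matrix.det_submatrix_equiv_self]
  exact Nat.not_succ_le_self _ (Nat.le_findGreatest (hP_le _ hP_succ) hP_succ)

theorem card_le_rank_of_det_submatrix_ne_zero {L : Type u} [Field L] {μ τ κ : Type*} [Fintype τ]
    [Fintype κ] [DecidableEq κ] {Y : Matrix μ τ L} {f : κ → μ} {g : κ → τ}
    (h : (Y.submatrix f g).det ≠ 0) : Fintype.card κ ≤ Y.rank := by
  rw [← Matrix.rank_of_isUnit _ ((Matrix.isUnit_iff_isUnit_det _).2 (isUnit_iff_ne_zero.2 h))]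
  exact Matrix.rank_submatrix_le Y f g

theorem map_eq_zero_of_mem_iInf_nullconeStratum {S : Type u} [CommRing S] {L : Type v} [Field L]
    {ψ : S →+* L} {Y : Matrix (Fin m) (Fin t) S} {Z : Matrix (Fin t) (Fin n) S}
    (hψ : Y.map ψ * Z.map ψ = 0) {g : S}
    (hg : g ∈ ⨅ (r : ℕ) (R : Fin r ↪ Fin m) (C : Fin r ↪ Fin t), nullconeStratum Y Z R C) :
    ψ g = 0 := by
  obtain ⟨r, R, C, hδ, hdefect⟩ := exists_minor_ne_zero_and_schurDefect_eq_zero (Y.map ψ)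
  simp only [Submodule.mem_iInf] at hg
  refine map_eq_zero_of_mem_awayContraction ψ ?_ ?_ (hg r R C)
  · rw [Ideal.span_le]
    rintro _ ⟨x | x, rfl⟩
    · rw [← map_schurDefect] at hdefect
      exact congrFun (congrFun hdefect x.1) x.2
    · rw [← Matrix.map_mul] at hψ
      exact congrFun (congrFun hψ (R x.1)) x.2
  · rwa [RingHom.map_det, RingHom.mapMatrix_apply, ← Matrix.submatrix_map]

theorem map_eq_zero_of_mem_iInf_rankStratum {S : Type u} [CommRing S] {L : Type v} [Field L]
    {ψ : S →+* L} {Y : Matrix (Fin m) (Fin t) S} {s : ℕ} (hψ : (Y.map ψ).rank ≤ s) {g : S}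
    (hg : g ∈ ⨅ (r : ℕ) (_ : r ≤ s) (R : Fin r ↪ Fin m) (C : Fin r ↪ Fin t), rankStratum Y R C) :
    ψ g = 0 := by
  obtain ⟨r, R, C, hδ, hdefect⟩ := exists_minor_ne_zero_and_schurDefect_eq_zero (Y.map ψ)
  have hr : r ≤ s := by
    simpa only [Fintype.card_fin] using (card_le_rank_of_det_submatrix_ne_zero hδ).trans hψ
  simp only [Submodule.mem_iInf] at hg
  refine map_eq_zero_of_mem_awayContraction ψ ?_ ?_ (hg r hr R C)
  · rw [Ideal.span_le]
    rintro _ ⟨x, rfl⟩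
    rw [← map_schurDefect] at hdefect
    exact congrFun (congrFun hdefect x.1) x.2
  · rwa [RingHom.map_det, RingHom.mapMatrix_apply, ← Matrix.submatrix_map]

end MaximalMinors

section StandardMonomials

theorem eq_of_forall_standard_exists_point {σ : Type u} {K : Type v} [Field K] {Γ₀ : Type*}
    [AddCommMonoid Γ₀] [LinearOrder Γ₀] [IsOrderedCancelAddMonoid Γ₀] [WellFoundedLT Γ₀]
    {Γ : Type w} [AddCommGroup Γ] [LinearOrder Γ] [IsOrderedAddMonoid Γ] {A : Type*} [Field A]
    [Algebra K A] {w₀ : σ → Γ₀} {w : σ → Γ} (hw : LinearIndependent ℕ w)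
    {I J : Ideal (MvPolynomial σ K)} (hIJ : I ≤ J) {standard : (σ →₀ ℕ) → Prop}
    (hlead : ∀ e, ¬ standard e → ∃ q ∈ I, ∃ e₀ ≤ e, HasLead w₀ q e₀)
    (hpoint : ∀ e, standard e → ∃ x : σ → HahnSeries Γ A,
      (∀ v, w v ≤ HahnSeries.addVal Γ A (x v) ∧
        (e v ≠ 0 → HahnSeries.addVal Γ A (x v) = w v)) ∧
      ∀ g ∈ J, MvPolynomial.aeval x g = 0) : I = J := by
  refine le_antisymm hIJ fun g hg => ?_
  obtain ⟨g', hsub, hstandard⟩ := exists_reduced_representative hlead g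
  have hg' : g' ∈ J := (Submodule.sub_mem_iff_right J hg).1 (hIJ hsub)
  suffices g' = 0 by rwa [this, sub_zero] at hsub
  by_contra hne
  obtain ⟨e, he, hne_zero⟩ := exists_support_forall_aeval_ne_zero (A := A) hw hne
  obtain ⟨x, hx, hvanish⟩ := hpoint e (hstandard e he)
  exact hne_zero x hx (hvanish g' hg')

theorem sum_single_one_le {ι σ : Type*} [Fintype ι] {v : ι → σ} (hv : Function.Injective v)
    {e : σ →₀ ℕ} (h : ∀ l, e (v l) ≠ 0) : ∑ l, Finsupp.single (v l) 1 ≤ e := by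
  classical
  intro u
  rw [Finsupp.finsetSum_apply]
  by_cases hu : ∃ l, v l = u
  · obtain ⟨l, rfl⟩ := hu
    rw [Fintype.sum_eq_single l fun l' hl' => Finsupp.single_eq_of_ne' fun h' => hl' (hv h'),
      Finsupp.single_eq_same]
    exact Nat.one_le_iff_ne_zero.2 (h l)
  · push Not at hu
    rw [Finset.sum_eq_zero fun l _ => Finsupp.single_eq_of_ne' (hu l)]
    exact Nat.zero_le _

variable {m t n : ℕ}

/-- The cells of the first matrix that occur in an exponent, indexed by column and row. -/
def cellsY (e : (Fin m × Fin t) ⊕ (Fin t × Fin n) →₀ ℕ) (c : Fin t) (i : Fin m) : Prop :=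
  e (Sum.inl (i, c)) ≠ 0

/-- The cells of the second matrix that occur in an exponent, indexed by row and column. -/
def cellsZ (e : (Fin m × Fin t) ⊕ (Fin t × Fin n) →₀ ℕ) (c : Fin t) (j : Fin n) : Prop :=
  e (Sum.inr (c, j)) ≠ 0

variable (K : Type u) [Field K]

theorem exists_hasLead_mem_minorsIdeal {r : ℕ} {e : (Fin m × Fin t) ⊕ (Fin t × Fin n) →₀ ℕ}
    (he : r < maxChainLength (cellsY e) 0) :
    ∃ q ∈ minorsIdeal (r + 1) (matY K m t n), ∃ e₀ ≤ e, HasLead (diagWeight m t n) q e₀ := by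
  obtain ⟨c, i, hc, hi, hF, -⟩ := (hasChain_maxChainLength (F := cellsY e) (k := 0)).mono he
  refine ⟨((matY K m t n).submatrix i c).det, Ideal.subset_span
    ⟨OrderEmbedding.ofStrictMono i hi, OrderEmbedding.ofStrictMono c hc, rfl⟩, _, ?_,
    hasLead_det_submatrix_matY K hi hc⟩
  refine sum_single_one_le (v := fun l => Sum.inl (i l, c l)) (fun l l' h => ?_) hF
  exact hi.injective (congrArg Prod.fst (Sum.inl_injective h))

theorem chainExponent_le {a b : ℕ} {i : Fin a → Fin m} {c : Fin a → Fin t} {d : Fin b → Fin t}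
    {j : Fin b → Fin n} (hi : Function.Injective i) (hj : Function.Injective j)
    {e : (Fin m × Fin t) ⊕ (Fin t × Fin n) →₀ ℕ} (hY : ∀ l, cellsY e (c l) (i l))
    (hZ : ∀ l, cellsZ e (d l) (j l)) : chainExponent i c d j ≤ e := by
  have hinj : Function.Injective (Sum.elim (fun l => Sum.inl (i l, c l)) fun l =>
      Sum.inr (d l, j l) : Fin a ⊕ Fin b → (Fin m × Fin t) ⊕ (Fin t × Fin n)) :=
    Function.Injective.sumElim
      (fun l l' h => hi (congrArg Prod.fst (Sum.inl_injective h)))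
      (fun l l' h => hj (congrArg Prod.snd (Sum.inr_injective h))) fun _ _ => Sum.inl_ne_inr
  have hle := sum_single_one_le hinj (Sum.forall.2 ⟨hY, hZ⟩)
  rwa [Fintype.sum_sum_type] at hle

theorem exists_hasLead_mem_nullconeIdeal {e : (Fin m × Fin t) ⊕ (Fin t × Fin n) →₀ ℕ} {k : ℕ}
    (hk : k ≤ t) (he : t - k < maxChainLength (cellsY e) k + maxChainLength (cellsZ e) k) :
    ∃ q ∈ nullconeIdeal K m t n, ∃ e₀ ≤ e, HasLead (diagWeight m t n) q e₀ := by
  have hleY := maxChainLength_le (F := cellsY e) (k := k)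
  obtain ⟨c, i, hc, hi, hFY, hkc⟩ := hasChain_maxChainLength (F := cellsY e) (k := k)
  obtain ⟨d, j, hd, hj, hFZ, hkd⟩ := (hasChain_maxChainLength (F := cellsZ e) (k := k)).mono
    (show t - k + 1 - maxChainLength (cellsY e) k ≤ _ by omega)
  refine ⟨(mixedMatrix (matY K m t n) (matZ K m t n) i c d j (Fin.castLE hk)).det, ?_, _,
    chainExponent_le hi.injective hj.injective hFY hFZ,
    hasLead_det_mixedMatrix hk K hi hc hd hj hkc hkd⟩
  refine Ideal.pow_le_self ?_ (det_mixedMatrix_mem_pow (H := nullconeIdeal K m t n)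
    (fun i j => Ideal.subset_span ⟨i, j, rfl⟩) i c d j (Fin.castLE hk))
  simp only [Fintype.card_fin]
  omega

end StandardMonomials

section Decompositions

variable (K : Type u) [Field K] {m t n : ℕ}

theorem map_aeval_matY {L : Type*} [CommRing L] [Algebra K L]
    (x : (Fin m × Fin t) ⊕ (Fin t × Fin n) → L) :
    (matY K m t n).map (MvPolynomial.aeval (R := K) x).toRingHom =
      Matrix.of fun i c => x (Sum.inl (i, c)) :=
  Matrix.ext fun _ _ => MvPolynomial.aeval_X x _

theorem map_aeval_matZ {L : Type*} [CommRing L] [Algebra K L]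
    (x : (Fin m × Fin t) ⊕ (Fin t × Fin n) → L) :
    (matZ K m t n).map (MvPolynomial.aeval (R := K) x).toRingHom =
      Matrix.of fun c j => x (Sum.inr (c, j)) :=
  Matrix.ext fun _ _ => MvPolynomial.aeval_X x _

theorem nullconeIdeal_eq_iInf_nullconeStratum (hm : 0 < m) (hn : 0 < n) :
    nullconeIdeal K m t n = ⨅ (r : ℕ) (R : Fin r ↪ Fin m) (C : Fin r ↪ Fin t),
      nullconeStratum (matY K m t n) (matZ K m t n) R C := by
  refine eq_of_forall_standard_exists_point (A := CoeffField K) (w₀ := diagWeight m t n)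
    (linearIndependent_genericWeight m t n)
    (le_iInf₂ fun _ R => le_iInf fun C => entriesIdeal_mul_le_nullconeStratum _ _ R C)
    (standard := fun e =>
      ∀ k ≤ t, maxChainLength (cellsY e) k + maxChainLength (cellsZ e) k ≤ t - k)
    (fun e he => ?_) fun e he => ?_
  · push Not at he
    obtain ⟨k, hk, hlt⟩ := he
    exact exists_hasLead_mem_nullconeIdeal K hk hlt
  · obtain ⟨Y, Z, hYZ, hY, hZ⟩ := exists_mul_eq_zero_of_maxChainLength_add_le
      (sum_X_pow_ne_zero K (r := t)) hm hn (isStrictMonge_genericWeight_inl m t n)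
      (isStrictMonge_genericWeight_inr m t n) (fun _ _ i j => genericWeight_add_lt m t n i j) he
    let x := Sum.elim (fun v : Fin m × Fin t => Y v.1 v.2) fun v : Fin t × Fin n => Z v.1 v.2
    let ψ := (MvPolynomial.aeval (R := K) x).toRingHom
    have hmul : (matY K m t n).map ψ * (matZ K m t n).map ψ = 0 :=
      (congrArg₂ (fun A B => A * B) (map_aeval_matY K x) (map_aeval_matZ K x)).trans hYZ
    exact ⟨x, Sum.forall.2 ⟨fun v => hY v.2 v.1, fun v => hZ v.1 v.2⟩,
      fun g hg => map_eq_zero_of_mem_iInf_nullconeStratum hmul hg⟩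

theorem minorsIdeal_matY_eq_iInf_rankStratum (hm : 0 < m) (s : ℕ) :
    minorsIdeal (s + 1) (matY K m t n) = ⨅ (r : ℕ) (_ : r ≤ s) (R : Fin r ↪ Fin m)
      (C : Fin r ↪ Fin t), rankStratum (matY K m t n) R C := by
  refine eq_of_forall_standard_exists_point (A := CoeffField K) (w₀ := diagWeight m t n)
    (linearIndependent_genericWeight m t n)
    (le_iInf₂ fun _ hr => le_iInf₂ fun R C => minorsIdeal_succ_le_rankStratum _ R C hr)
    (standard := fun e => maxChainLength (cellsY e) 0 ≤ s)
    (fun e he => exists_hasLead_mem_minorsIdeal K (not_le.1 he)) fun e he => ?_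
  obtain ⟨U, V, hUV⟩ := exists_mul_of_maxChainLength_le (sum_X_pow_ne_zero K (r := s)) hm
    (isStrictMonge_genericWeight_inl m t n) he
  have hZ v := addVal_single_one (A := CoeffField K) (genericWeight m t n (Sum.inr v))
  refine ⟨Sum.elim (fun v => (U * V) v.1 v.2) fun v => HahnSeries.single
    (genericWeight m t n (Sum.inr v)) 1,
    Sum.forall.2 ⟨fun v => hUV v.2 v.1, fun v => ⟨(hZ v).ge, fun _ => hZ v⟩⟩, fun g hg => ?_⟩
  refine map_eq_zero_of_mem_iInf_rankStratum ?_ hg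
  refine (congrArg Matrix.rank (map_aeval_matY K _)).trans_le ?_
  exact (Matrix.rank_mul_le_left U V).trans
    ((Matrix.rank_le_card_width U).trans_eq (Fintype.card_fin s))

end Decompositions

section Compatibility

theorem isCompatiblySplit_iInf {S : Type u} [CommRing S] {θ : S →+ S} {ι : Sort*}
    {I : ι → Ideal S} (hI : ∀ i, IsCompatiblySplit θ (I i)) : IsCompatiblySplit θ (⨅ i, I i) :=
  fun g hg => (Submodule.mem_iInf _).2 fun i => hI i g ((Submodule.mem_iInf _).1 hg i)

variable {K : Type u} [Field K] {m t n : ℕ} (p : ℕ) [Fact p.Prime] [CharP K p] {φ : K →+ K}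

theorem isCompatiblySplit_nullconeIdeal (hφ : ∀ a b, φ (a ^ p * b) = a * φ b) (hm : t ≤ m)
    (hn : t ≤ n) (hm_pos : 0 < m) (hn_pos : 0 < n) :
    IsCompatiblySplit (complexSplitting p φ hm hn) (nullconeIdeal K m t n) := by
  rw [nullconeIdeal_eq_iInf_nullconeStratum K hm_pos hn_pos]
  exact isCompatiblySplit_iInf fun r => isCompatiblySplit_iInf fun R =>
    isCompatiblySplit_iInf fun C => isCompatiblySplit_nullconeStratum _ _ R C
      (Nat.Prime.pos Fact.out) (frobTrace_pow_mul p φ hφ) hm hn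

theorem isCompatiblySplit_minorsIdeal_matY (hφ : ∀ a b, φ (a ^ p * b) = a * φ b) (hm : t ≤ m)
    (hn : t ≤ n) (hm_pos : 0 < m) (s : ℕ) :
    IsCompatiblySplit (complexSplitting p φ hm hn) (minorsIdeal (s + 1) (matY K m t n)) := by
  rw [minorsIdeal_matY_eq_iInf_rankStratum K hm_pos]
  exact isCompatiblySplit_iInf fun r => isCompatiblySplit_iInf fun _ =>
    isCompatiblySplit_iInf fun R => isCompatiblySplit_iInf fun C =>
      isCompatiblySplit_rankStratum _ _ R C (Nat.Prime.pos Fact.out) (frobTrace_pow_mul p φ hφ)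
        hm hn

end Compatibility

section Swap

open MvPolynomial

variable {K : Type u} [Field K] {m t n : ℕ}

variable (m t n) in
/-- The bijection of the variables that exchanges the two matrices and transposes them. -/
def swapVars : (Fin m × Fin t) ⊕ (Fin t × Fin n) ≃ (Fin n × Fin t) ⊕ (Fin t × Fin m) :=
  (Equiv.sumComm _ _).trans ((Equiv.prodComm _ _).sumCongr (Equiv.prodComm _ _))

theorem map_rename_swapVars_matY :
    (matY K m t n).map (rename (R := K) (swapVars m t n)) = (matZ K n t m).transpose :=
  Matrix.ext fun _ _ => rename_X _ _

theorem map_rename_swapVars_matZ :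
    (matZ K m t n).map (rename (R := K) (swapVars m t n)) = (matY K n t m).transpose :=
  Matrix.ext fun _ _ => rename_X _ _

theorem rename_swapVars_swapVars (g : PolyYZ K m t n) :
    rename (swapVars n t m) (rename (swapVars m t n) g) = g := by
  have h : swapVars n t m ∘ swapVars m t n = id := by
    funext v
    rcases v with v | v <;> rfl
  rw [rename_rename, h, rename_id_apply]

theorem rename_complexSplitting (p : ℕ) [Fact p.Prime] (φ : K →+ K) (hm : t ≤ m) (hn : t ≤ n)
    (g : PolyYZ K m t n) :
    rename (swapVars m t n) (complexSplitting p φ hm hn g) =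
      complexSplitting p φ hn hm (rename (swapVars m t n) g) := by
  have hpoly : rename (swapVars m t n) (splittingPoly hm hn (matY K m t n) (matZ K m t n)) =
      splittingPoly hn hm (matY K n t m) (matZ K n t m) := by
    refine (map_splittingPoly (rename (R := K) (swapVars m t n)).toRingHom hm hn _ _).trans
      (Eq.trans ?_ (splittingPoly_transpose hn hm (matY K n t m) (matZ K n t m)))
    exact congrArg₂ _ map_rename_swapVars_matY map_rename_swapVars_matZ
  simp only [complexSplitting, AddMonoidHom.comp_apply, AddMonoidHom.coe_mulLeft]
  rw [rename_frobTrace, map_mul, map_pow, hpoly]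

theorem map_mem_minorsIdeal {S : Type u} [CommRing S] {S' : Type v} [CommRing S'] (ψ : S →+* S')
    {a b k : ℕ} {A : Matrix (Fin a) (Fin b) S} {g : S} (hg : g ∈ minorsIdeal k A) :
    ψ g ∈ minorsIdeal k (A.map ψ) := by
  suffices minorsIdeal k A ≤ (minorsIdeal k (A.map ψ)).comap ψ from this hg
  refine Ideal.span_le.2 ?_
  rintro _ ⟨f, g, rfl⟩
  exact Ideal.subset_span ⟨f, g, RingHom.map_det ψ _⟩

theorem minorsIdeal_transpose {S : Type u} [CommRing S] {a b k : ℕ}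
    (A : Matrix (Fin a) (Fin b) S) : minorsIdeal k A.transpose = minorsIdeal k A := by
  have hle {a b : ℕ} (A : Matrix (Fin a) (Fin b) S) :
      minorsIdeal k A.transpose ≤ minorsIdeal k A := by
    refine Ideal.span_le.2 ?_
    rintro _ ⟨f, g, rfl⟩
    exact Ideal.subset_span ⟨g, f, Matrix.det_transpose (A.submatrix g f)⟩
  exact le_antisymm (hle A) (hle A.transpose)

theorem rename_swapVars_mem_minorsIdeal_matZ {k : ℕ} {g : PolyYZ K m t n}
    (hg : g ∈ minorsIdeal k (matY K m t n)) :
    rename (swapVars m t n) g ∈ minorsIdeal k (matZ K n t m) := by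
  rw [← minorsIdeal_transpose, ← map_rename_swapVars_matY]
  exact map_mem_minorsIdeal (rename (R := K) (swapVars m t n)).toRingHom hg

theorem rename_swapVars_mem_minorsIdeal_matY {k : ℕ} {g : PolyYZ K m t n}
    (hg : g ∈ minorsIdeal k (matZ K m t n)) :
    rename (swapVars m t n) g ∈ minorsIdeal k (matY K n t m) := by
  rw [← minorsIdeal_transpose, ← map_rename_swapVars_matZ]
  exact map_mem_minorsIdeal (rename (R := K) (swapVars m t n)).toRingHom hg

variable (p : ℕ) [Fact p.Prime] [CharP K p] {φ : K →+ K}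

theorem isCompatiblySplit_minorsIdeal_matZ (hφ : ∀ a b, φ (a ^ p * b) = a * φ b) (hm : t ≤ m)
    (hn : t ≤ n) (hn_pos : 0 < n) (s : ℕ) :
    IsCompatiblySplit (complexSplitting p φ hm hn) (minorsIdeal (s + 1) (matZ K m t n)) := by
  intro g hg
  have hswap := isCompatiblySplit_minorsIdeal_matY p hφ hn hm hn_pos s _
    (rename_swapVars_mem_minorsIdeal_matY hg)
  rw [← rename_complexSplitting] at hswap
  rw [← rename_swapVars_swapVars (complexSplitting p φ hm hn g)]
  exact rename_swapVars_mem_minorsIdeal_matZ hswap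

theorem isCompatiblySplit_complexIdeal (hφ : ∀ a b, φ (a ^ p * b) = a * φ b) (hm : t ≤ m)
    (hn : t ≤ n) (hm_pos : 0 < m) (hn_pos : 0 < n) (r s : ℕ) :
    IsCompatiblySplit (complexSplitting p φ hm hn) (complexIdeal K m t n r s) :=
  isCompatiblySplit_sup (isCompatiblySplit_sup
    (isCompatiblySplit_minorsIdeal_matY p hφ hm hn hm_pos r)
    (isCompatiblySplit_minorsIdeal_matZ p hφ hm hn hn_pos s))
    (isCompatiblySplit_nullconeIdeal p hφ hm hn hm_pos hn_pos)

end Swap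

section Purity

theorem ringHomIsPure_of_leftInverse {A : Type u} {B : Type v} [CommRing A] [CommRing B]
    (f : A →+* B) (θ : B →+ A) (hθ : ∀ a b, θ (f a * b) = a * θ b) (hθf : ∀ a, θ (f a) = a) :
    RingHomIsPure.{u, v, w} f := by
  let : Algebra A B := f.toAlgebra
  intro M _ _
  let ρ : B →ₗ[A] A :=
    { toFun := θ
      map_add' := map_add θ
      map_smul' := fun a b => by rw [Algebra.smul_def]; exact hθ a b }
  have hρ : ρ ∘ₗ Algebra.linearMap A B = LinearMap.id := LinearMap.ext hθf
  refine Function.LeftInverse.injective (g := ρ.rTensor M) fun x => ?_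
  rw [← LinearMap.comp_apply, ← LinearMap.rTensor_comp, hρ, LinearMap.rTensor_id,
    LinearMap.id_apply]

theorem IsFrobeniusSplitting.isFPure_quotient {S : Type u} [CommRing S] {p : ℕ} [ExpChar S p]
    {I : Ideal S} [ExpChar (S ⧸ I) p] {θ : S →+ S} (hθ : IsFrobeniusSplitting p θ)
    (hI : IsCompatiblySplit θ I) : IsFPure.{u, w} p (S ⧸ I) := by
  let θ' : S ⧸ I →+ S ⧸ I := QuotientAddGroup.map I.toAddSubgroup I.toAddSubgroup θ hI
  have hθ' a : θ' (Ideal.Quotient.mk I a) = Ideal.Quotient.mk I (θ a) := rfl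
  refine ringHomIsPure_of_leftInverse _ θ' (fun a b => ?_) fun a => ?_
  · obtain ⟨a, rfl⟩ := Ideal.Quotient.mk_surjective a
    obtain ⟨b, rfl⟩ := Ideal.Quotient.mk_surjective b
    rw [← RingHom.map_frobenius, ← map_mul, hθ', hθ', ← map_mul, hθ.map_frobenius_mul]
  · obtain ⟨a, rfl⟩ := Ideal.Quotient.mk_surjective a
    rw [← RingHom.map_frobenius, hθ', hθ.map_frobenius]

end Purity

section Retraction

open MvPolynomial

variable {K : Type u} [Field K] {m m' t n n' : ℕ}

/-- The inclusion of the variables of smaller matrices. -/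
noncomputable def enlarge (K : Type u) [Field K] (t : ℕ) (hm : m ≤ m') (hn : n ≤ n') :
    PolyYZ K m t n →ₐ[K] PolyYZ K m' t n' :=
  rename (Sum.map (Prod.map (Fin.castLE hm) id) (Prod.map id (Fin.castLE hn)))

/-- The map that annihilates the last rows of the first and the last columns of the second
matrix. -/
noncomputable def truncate (K : Type u) [Field K] (m m' t n n' : ℕ) :
    PolyYZ K m' t n' →ₐ[K] PolyYZ K m t n :=
  aeval (Sum.elim
    (fun v => if h : (v.1 : ℕ) < m then X (Sum.inl (⟨v.1, h⟩, v.2)) else 0)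
    (fun v => if h : (v.2 : ℕ) < n then X (Sum.inr (v.1, ⟨v.2, h⟩)) else 0))

theorem truncate_enlarge (hm : m ≤ m') (hn : n ≤ n') (g : PolyYZ K m t n) :
    truncate K m m' t n n' (enlarge K t hm hn g) = g := by
  suffices h : (truncate K m m' t n n').comp (enlarge K t hm hn) = AlgHom.id K _ from
    DFunLike.congr_fun h g
  ext (v | v) <;> simp [truncate, enlarge]

theorem enlarge_mem_nullconeIdeal (hm : m ≤ m') (hn : n ≤ n') {g : PolyYZ K m t n}
    (hg : g ∈ nullconeIdeal K m t n) : enlarge K t hm hn g ∈ nullconeIdeal K m' t n' := by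
  suffices nullconeIdeal K m t n ≤ (nullconeIdeal K m' t n').comap (enlarge K t hm hn) from
    this hg
  refine Ideal.span_le.2 ?_
  rintro _ ⟨i, j, rfl⟩
  refine Ideal.subset_span ⟨Fin.castLE hm i, Fin.castLE hn j, ?_⟩
  simp [Matrix.mul_apply, matY, matZ, enlarge]

theorem truncate_mem_nullconeIdeal {g : PolyYZ K m' t n'} (hg : g ∈ nullconeIdeal K m' t n') :
    truncate K m m' t n n' g ∈ nullconeIdeal K m t n := by
  suffices nullconeIdeal K m' t n' ≤
    (nullconeIdeal K m t n).comap (truncate K m m' t n n') from this hg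
  refine Ideal.span_le.2 ?_
  rintro _ ⟨i, j, rfl⟩
  rw [SetLike.mem_coe, Ideal.mem_comap]
  by_cases hi : (i : ℕ) < m
  · by_cases hj : (j : ℕ) < n
    · refine Ideal.subset_span ⟨⟨i, hi⟩, ⟨j, hj⟩, ?_⟩
      simp [Matrix.mul_apply, matY, matZ, truncate, hi, hj]
    · simp [Matrix.mul_apply, matY, matZ, truncate, hj]
  · simp [Matrix.mul_apply, matY, matZ, truncate, hi]

theorem isFPure_genericNullcone_of_le {p : ℕ} [ExpChar K p] (hm : m ≤ m') (hn : n ≤ n')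
    {θ : PolyYZ K m' t n' →+ PolyYZ K m' t n'} (hθ : IsFrobeniusSplitting p θ)
    (hI : IsCompatiblySplit θ (nullconeIdeal K m' t n')) :
    IsFPure.{u, w} p (GenericNullcone K m t n) := by
  let θ' : PolyYZ K m t n →+ PolyYZ K m t n :=
    ((truncate K m m' t n n' : _ →+* _).toAddMonoidHom.comp θ).comp
      (enlarge K t hm hn : _ →+* _).toAddMonoidHom
  have hθ' g : θ' g = truncate K m m' t n n' (θ (enlarge K t hm hn g)) := rfl
  have hsplit : IsFrobeniusSplitting p θ' := by
    refine ⟨fun a b => ?_, fun a => ?_⟩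
    · rw [hθ', hθ', frobenius_def, map_mul, map_pow, ← frobenius_def, hθ.map_frobenius_mul,
        map_mul, truncate_enlarge]
    · rw [hθ', frobenius_def, map_pow, ← frobenius_def, hθ.map_frobenius, truncate_enlarge]
  exact hsplit.isFPure_quotient fun g hg =>
    truncate_mem_nullconeIdeal (hI _ (enlarge_mem_nullconeIdeal hm hn hg))

end Retraction

theorem mainTheorem5_general {K : Type u} [Field K] (p : ℕ) [Fact p.Prime] [CharP K p]
    (m t n : ℕ) (hm : 0 < m) (hn : 0 < n) :
    (t ≤ min m n →
      ∃ θ : PolyYZ K m t n →+ PolyYZ K m t n, IsFrobeniusSplitting p θ ∧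
        ∀ r s : ℕ, IsCompatiblySplit θ (complexIdeal K m t n r s)) ∧
    IsFPure.{u, w} p (GenericNullcone K m t n) := by
  obtain ⟨φ, hφ_one, hφ⟩ := exists_frobenius_inverse_linear K p
  constructor
  · intro ht
    obtain ⟨htm, htn⟩ := le_min_iff.1 ht
    exact ⟨complexSplitting p φ htm htn, isFrobeniusSplitting_complexSplitting p hφ_one hφ htm htn,
      isCompatiblySplit_complexIdeal p hφ htm htn hm hn⟩
  · have htm : t ≤ max m t := le_max_right m t
    have htn : t ≤ max n t := le_max_right n t
    exact isFPure_genericNullcone_of_le (le_max_left m t) (le_max_left n t)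
      (isFrobeniusSplitting_complexSplitting p hφ_one hφ htm htn)
      (isCompatiblySplit_nullconeIdeal p hφ htm htn (lt_max_of_lt_left hm) (lt_max_of_lt_left hn))

theorem mainTheorem5 {K : Type u} [Field K] (p : ℕ) [Fact p.Prime] [CharP K p]
    (hK : IsFFinite p K) (m t n : ℕ) (hm : 0 < m) (ht : 0 < t) (hn : 0 < n) :
    (t ≤ min m n →
      ∃ θ : PolyYZ K m t n →+ PolyYZ K m t n, IsFrobeniusSplitting p θ ∧
        ∀ r s : ℕ, r + s ≤ t → IsCompatiblySplit θ (complexIdeal K m t n r s)) ∧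
    IsFPure.{u, w} p (GenericNullcone K m t n) :=
  (mainTheorem5_general p m t n hm hn).imp_left fun h htmn =>
    (h htmn).imp fun _ hθ => ⟨hθ.1, fun r s _ => hθ.2 r s⟩
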